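/- \textbf{Conventions.} Work in $\mathbb R^n$ with lattice $\mathbb Z^n$. For a set $\sigma\subseteq\mathbb R^n$ let $N_\sigma$ be the lattice of integer vectors parallel to the affine span of $\sigma$. A weighted polyhedral complex $X$ of codimension $k$ has a number $\operatorname{mult}_\sigma(X)$ attached to each facet (cell of dimension $n-k$) $\sigma$; if $x$ lies in the relative interior of a facet $\sigma$, put $\operatorname{mult}_x(X)=\operatorname{mult}_\sigma(X)$. The link of a polyhedron $\sigma$ at $\omega\in\sigma$ is $\operatorname{link}_\omega\sigma=\{u : \omega+\varepsilon u\in\sigma \text{ for all sufficiently small } \varepsilon>0\}$, and the support of $\operatorname{link}_\omega X$ is the union of $\operatorname{link}_\omega\sigma$ over the facets $\sigma\ni\omega$ of $X$ with nonzero multiplicity. \textbf{Stable intersection.} $X\cdot Y$ has codimension $\operatorname{codim}X+\operatorname{codim}Y$; its cells are the non-empty intersections $\sigma\cap\tau$ of cells $\sigma\in X$, $\tau\in Y$ that lie in $$\{\omega : \operatorname{supp}(\operatorname{link}_\omega X)-\operatorname{supp}(\operatorname{link}_\omega Y)=\mathbb R^n\},$$ and the multiplicity of a facet $\gamma$ is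 the value, constant for $v$ in a dense open subset of $\mathbb R^n$, of $$\sum_{\sigma,\tau}\operatorname{mult}_\sigma(X)\,\operatorname{mult}_\tau(Y)\,[\mathbb Z^n:N_\sigma+N_\tau],$$ where $\omega$ is a point in the relative interior of $\gamma$ and the sum is over pairs of facets $\sigma\ni\omega$ of $X$ and $\tau\ni\omega$ of $Y$ with $v\in\operatorname{link}_\omega\sigma-\operatorname{link}_\omega\tau$. \textbf{Tropical hypersurface.} Let $P$ be a non-empty rational polytope, i.e. the convex hull of finitely many points of $\mathbb Q^n$. Its tropical hypersurface $\mathcal T(P)$ is the set of outer normal cones of $P$ of dimension at most $n-1$, of codimension $1$, where the multiplicity of the normal cone of an edge $e$ is the lattice length of $e$, i.e. the number $\ell>0$ such that the endpoints of $e$ differ by $\ell$ times a primitive integer vector. Put $\mathcal T^0(P)=\mathbb R^n$ with multiplicity $1$, and $\mathcal T^{r+1}(P)=\mathcal T(P)\cdot\mathcal T^r(P)$. \textbf{Theorem.} Let $P\subset\mathbb R^n$ be a non-empty rational polytope. Then the origin lies in the relative interior of a facet of $\mathcal T^{\dim P}(P)$, and $$\operatorname{vol}(P)=\operatorname{mult}_0\bigl(\mathcal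 T^{\dim P}(P)\bigr),$$ where $\operatorname{vol}$ is the $\dim(P)$-dimensional volume normalized to the lattice $\Lambda$ of integer vectors parallel to the affine span of $P$, so that a simplex whose edge vectors at one vertex form a basis of $\Lambda$ has volume $1$; that is, $\operatorname{vol}(P)$ is $(\dim P)!$ times the volume of $P$ in units of a fundamental domain of $\Lambda$. -/

import Mathlib

/-! Weighted polyhedral complexes in `ℝⁿ`, stable intersection, tropical hypersurfaces of
rational polytopes and their stable powers, and normalized lattice volume. The lattice is `ℤⁿ`. -/

namespace StableVolume

noncomputable section

/-- The inclusion `ℤⁿ → ℝⁿ`. -/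
def intVec (n : ℕ) : (Fin n → ℤ) →ₗ[ℤ] (Fin n → ℝ) :=
  (Algebra.linearMap ℤ ℝ).compLeft (Fin n)

/-- The dimension of a set: the dimension of the linear space parallel to its affine span. -/
def dim {n : ℕ} (s : Set (Fin n → ℝ)) : ℕ :=
  Module.finrank ℝ (vectorSpan ℝ s)

/-- The maximal sublattice of `ℤⁿ` parallel to the affine span of `s`. -/
def lattice {n : ℕ} (s : Set (Fin n → ℝ)) : Submodule ℤ (Fin n → ℤ) :=
  ((vectorSpan ℝ s).restrictScalars ℤ).comap (intVec n)

/-- The lattice index `[ℤⁿ : N_σ + N_τ]`. -/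
def latticeIndex {n : ℕ} (σ τ : Set (Fin n → ℝ)) : ℕ :=
  (lattice σ ⊔ lattice τ).toAddSubgroup.index

/-- The link of the polyhedron `σ` at a point `v ∈ σ`. -/
def link {n : ℕ} (v : Fin n → ℝ) (σ : Set (Fin n → ℝ)) : Set (Fin n → ℝ) :=
  {u | ∃ δ : ℝ, 0 < δ ∧ ∀ ε : ℝ, 0 < ε → ε < δ → v + ε • u ∈ σ}

/-- The data of a weighted pure polyhedral complex of the given codimension: its cells (of all
dimensions), and a multiplicity of each facet. Values of `mult` on sets that are not facets are
irrelevant. -/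
structure WeightedComplex (n : ℕ) where
  cells : Set (Set (Fin n → ℝ))
  codim : ℕ
  mult : Set (Fin n → ℝ) → ℝ

namespace WeightedComplex

variable {n : ℕ}

/-- The facets: the cells of dimension `n - codim`. -/
def facets (X : WeightedComplex n) : Set (Set (Fin n → ℝ)) :=
  {σ | σ ∈ X.cells ∧ dim σ + X.codim = n}

/-- The support of the link of `X` at `ω`: the union of the links at `ω` of the facets with
nonzero multiplicity that contain `ω`. -/
def linkSupport (X : WeightedComplex n) (ω : Fin n → ℝ) : Set (Fin n → ℝ) :=
  {u | ∃ σ ∈ X.facets, X.mult σ ≠ 0 ∧ ω ∈ σ ∧ u ∈ link ω σ}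

/-- The support of the stable intersection: the points `ω` at which
`link_ω X - link_ω Y` (Minkowski difference) is all of `ℝⁿ`. -/
def stableSupport (X Y : WeightedComplex n) : Set (Fin n → ℝ) :=
  {ω | ∀ v : Fin n → ℝ, ∃ x ∈ X.linkSupport ω, ∃ y ∈ Y.linkSupport ω, v = x - y}

open Classical in
/-- The multiplicity of `link_ω X - link_ω Y` at the point `v`, for `v` generic: the sum of
`mult σ * mult τ * [ℤⁿ : N_σ + N_τ]` over all pairs of facets `σ` of `X` and `τ` of `Y` through `ω`
with `v ∈ link_ω σ - link_ω τ`. (Facets of the links correspond to facets through `ω`, and have the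
same parallel lattices.) -/
def displacedMult (X Y : WeightedComplex n) (ω v : Fin n → ℝ) : ℝ :=
  ∑ᶠ (σ ∈ X.facets) (τ ∈ Y.facets),
    if ω ∈ σ ∧ ω ∈ τ ∧ ∃ x ∈ link ω σ, ∃ y ∈ link ω τ, v = x - y then
      X.mult σ * Y.mult τ * (latticeIndex σ τ : ℝ)
    else 0

/-- `c` is the multiplicity of `γ` in the stable intersection of `X` and `Y`: at points `ω` in the
relative interior of `γ`, the complex `link_ω X - link_ω Y` has multiplicity `c` on a dense open
subset of `ℝⁿ`. -/
def IsStableMult (X Y : WeightedComplex n) (γ : Set (Fin n → ℝ)) (c : ℝ) : Prop :=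
  ∀ ω ∈ intrinsicInterior ℝ γ, ∃ U : Set (Fin n → ℝ),
    IsOpen U ∧ Dense U ∧ ∀ v ∈ U, X.displacedMult Y ω v = c

open Classical in
/-- The stable intersection `X · Y`, with the cells of the common refinement
`{σ ∩ τ : σ ∈ X, τ ∈ Y}` that lie in the stable support. -/
def stableInter (X Y : WeightedComplex n) : WeightedComplex n where
  cells := {γ | γ.Nonempty ∧ (∃ σ ∈ X.cells, ∃ τ ∈ Y.cells, γ = σ ∩ τ) ∧ γ ⊆ X.stableSupport Y}
  codim := X.codim + Y.codim
  mult γ := if h : ∃ c, X.IsStableMult Y γ c then h.choose else 0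

/-- The complex `ℝⁿ` with multiplicity one. -/
def whole (n : ℕ) : WeightedComplex n where
  cells := {Set.univ}
  codim := 0
  mult _ := 1

/-- The point `x` lies in the relative interior of a facet of `X`, and `mult_x X = m`. -/
def HasMultAt (X : WeightedComplex n) (x : Fin n → ℝ) (m : ℝ) : Prop :=
  (∃ σ ∈ X.facets, x ∈ intrinsicInterior ℝ σ) ∧
    ∀ σ ∈ X.facets, x ∈ intrinsicInterior ℝ σ → X.mult σ = m

end WeightedComplex

/-- A rational polytope: the convex hull of finitely many points of `ℚⁿ`. -/
def IsRationalPolytope {n : ℕ} (P : Set (Fin n → ℝ)) : Prop :=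
  ∃ V : Finset (Fin n → ℚ), P = convexHull ℝ ((fun v i => (v i : ℝ)) '' (V : Set (Fin n → ℚ)))

/-- The face of `P` on which the functional `ω` is maximal. -/
def face {n : ℕ} (P : Set (Fin n → ℝ)) (ω : Fin n → ℝ) : Set (Fin n → ℝ) :=
  {x | x ∈ P ∧ ∀ y ∈ P, ω ⬝ᵥ y ≤ ω ⬝ᵥ x}

/-- The (outer) normal cone of a face `F` of `P`. -/
def normalCone {n : ℕ} (P F : Set (Fin n → ℝ)) : Set (Fin n → ℝ) :=
  {ω | F ⊆ face P ω}

/-- The face of `P` dual to a normal cone `C`. -/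
def dualFace {n : ℕ} (P C : Set (Fin n → ℝ)) : Set (Fin n → ℝ) :=
  {x | x ∈ P ∧ ∀ ω ∈ C, x ∈ face P ω}

/-- The lattice length of a segment `e`: the largest `ℓ` such that two points of `e` differ by
`ℓ` times a primitive integer vector. -/
def latticeLength {n : ℕ} (e : Set (Fin n → ℝ)) : ℝ :=
  sSup {l : ℝ | ∃ a ∈ e, ∃ b ∈ e, ∃ p : Fin n → ℤ,
    Finset.univ.gcd p = 1 ∧ b - a = l • intVec n p}

/-- The tropical hypersurface of `P`: the normal cones of `P` of dimension at most `n - 1`; the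
multiplicity of a cone of dimension `n - 1` is the lattice length of the edge dual to it. -/
def tropicalHypersurface {n : ℕ} (P : Set (Fin n → ℝ)) : WeightedComplex n where
  cells := {C | (∃ ω, C = normalCone P (face P ω)) ∧ dim C + 1 ≤ n}
  codim := 1
  mult C := latticeLength (dualFace P C)

/-- The `r`-fold stable self-intersection of the tropical hypersurface of `P`. -/
def tropicalPower {n : ℕ} (P : Set (Fin n → ℝ)) : ℕ → WeightedComplex n
  | 0 => WeightedComplex.whole n
  | r + 1 => (tropicalHypersurface P).stableInter (tropicalPower P r)

open Classical in
/-- The `dim P`-dimensional volume of `P`, normalized with respect to the lattice `Λ` of integer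
vectors parallel to the affine span of `P`: a simplex whose edge vectors at a vertex form a basis
of `Λ` has volume one. That is, `(dim P)!` times the Lebesgue measure of `P` in the affine
coordinates given by a point of `P` and a basis of `Λ`. -/
def normalizedVolume {n : ℕ} (P : Set (Fin n → ℝ)) : ℝ :=
  if h : P.Nonempty then
    ((dim P).factorial : ℝ) *
      (MeasureTheory.volume {x : Fin (Module.finrank ℤ (lattice P)) → ℝ |
        h.some + ∑ i, x i • intVec n (Module.finBasis ℤ (lattice P) i) ∈ P}).toReal
  else 0

end

end StableVolume

namespace StableVolume

open Filter Topology Set MeasureTheory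
open scoped Pointwise

/-! ### Exposed faces of polytopes -/

variable {n : ℕ}

/-! The statement is strengthened so that induction on `r` applies: for `r ≥ 1` the facets of the
`r`-th stable power are the normal cones of the `r`-dimensional faces `F` of `P`, weighted by the
normalized volume of `F` (`IsVolumeFan`). For `r = dim P` the only such face is `P`, and its normal
cone is a linear space, which has the origin in its relative interior.

In the inductive step let `dim F = r + 1` and let `ω` be a relative interior point of the normal
cone of `F`. Then `face P ω = F`, and links at `ω` of normal cones of `P` are normal cones of `F`
(`link_normalCone`). The multiplicity is thus a sum over edges `E` and facets `G` of `F`. With `u`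
the primitive outer normal of `G` and `p` the primitive direction of `E`, the lattice index is `|u
⬝ᵥ p|` (`latticeIndex_normalCone`), so a pair contributes vol(G) times the extent of `E` in
direction `u`.

Modulo lineality the normal cone of `G` is the ray spanned by `u`. Hence `E` is counted exactly when
the ray `v + t • u`, `t ≥ 0`, meets the normal cone of `E`. Along this ray the maximizing face
climbs monotonically in `u`-height, from the vertex `w` selected by `v` up to the level of `G`. For
generic `v` the crossed edges tile this range of heights, so their extents add up to the lattice
distance from `w` to `G` (`sum_extent_crossed_edges`). What remains is the sum over `G` of vol(G)
times this distance, which is vol(F) by the decomposition of `F` into pyramids with apex `w`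
(`normalizedVolume_eq_sum`). The vertex `w` depends on `v`, the result does not. -/

/-- `F` is a (non-empty, exposed) face of `P`. -/
def IsFace (P F : Set (Fin n → ℝ)) : Prop := ∃ ω, F = face P ω

theorem isFace_face (P : Set (Fin n → ℝ)) (ω : Fin n → ℝ) : IsFace P (face P ω) := ⟨ω, rfl⟩

theorem isFace_self (P : Set (Fin n → ℝ)) : IsFace P P :=
  ⟨0, by ext x; simp [face]⟩

theorem face_subset (P : Set (Fin n → ℝ)) (ω : Fin n → ℝ) : face P ω ⊆ P := fun _ h => h.1

theorem IsFace.subset {P F : Set (Fin n → ℝ)} (h : IsFace P F) : F ⊆ P := by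
  obtain ⟨ω, rfl⟩ := h; exact face_subset P ω

theorem dotProduct_eq_of_mem_face {P : Set (Fin n → ℝ)} {ω x y : Fin n → ℝ} (hx : x ∈ face P ω)
    (hy : y ∈ face P ω) : ω ⬝ᵥ x = ω ⬝ᵥ y :=
  le_antisymm (hy.2 x hx.1) (hx.2 y hy.1)

theorem mem_face_of_le {P : Set (Fin n → ℝ)} {ω x y : Fin n → ℝ} (hx : x ∈ face P ω)
    (hy : y ∈ P) (h : ω ⬝ᵥ x ≤ ω ⬝ᵥ y) : y ∈ face P ω :=
  ⟨hy, fun z hz => (hx.2 z hz).trans h⟩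

theorem convex_face {P : Set (Fin n → ℝ)} (hP : Convex ℝ P) (ω : Fin n → ℝ) :
    Convex ℝ (face P ω) := by
  intro x hx y hy a b ha hb hab
  refine ⟨hP hx.1 hy.1 ha hb hab, fun z hz => ?_⟩
  rw [dotProduct_add, dotProduct_smul, dotProduct_smul, smul_eq_mul, smul_eq_mul]
  have h1 := hx.2 z hz
  have h2 := hy.2 z hz
  calc ω ⬝ᵥ z = a * (ω ⬝ᵥ z) + b * (ω ⬝ᵥ z) := by rw [← add_mul, hab, one_mul]
    _ ≤ _ := by gcongr

theorem convex_setOf_dotProduct_le (ω : Fin n → ℝ) (c : ℝ) :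
    Convex ℝ {x : Fin n → ℝ | ω ⬝ᵥ x ≤ c} :=
  convex_halfSpace_le (f := fun x => ω ⬝ᵥ x) ⟨fun _ _ => dotProduct_add _ _ _, fun _ _ => dotProduct_smul _ _ _⟩ c

theorem mem_face_convexHull {S : Set (Fin n → ℝ)} {ω x : Fin n → ℝ} (hx : x ∈ convexHull ℝ S)
    (h : ∀ y ∈ S, ω ⬝ᵥ y ≤ ω ⬝ᵥ x) : x ∈ face (convexHull ℝ S) ω :=
  ⟨hx, fun _ hy => convexHull_min h (convex_setOf_dotProduct_le ω _) hy⟩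

/-- A face of a convex hull is the convex hull of the generators it contains. -/
theorem face_convexHull (S : Set (Fin n → ℝ)) (ω : Fin n → ℝ) :
    face (convexHull ℝ S) ω = convexHull ℝ (S ∩ face (convexHull ℝ S) ω) := by
  apply Subset.antisymm
  · intro x hx
    obtain ⟨ι, t, w, z, hw0, hw1, hz, hxe⟩ := (mem_convexHull_iff_exists_fintype.mp hx.1)
    -- The gaps `ω ⬝ᵥ x - ω ⬝ᵥ z i` are nonnegative and their weighted average vanishes, so only
    -- points of the face carry weight.
    have key : ∀ i, w i ≠ 0 → z i ∈ face (convexHull ℝ S) ω := by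
      have hle : ∀ i, ω ⬝ᵥ z i ≤ ω ⬝ᵥ x := fun i => hx.2 _ (subset_convexHull ℝ S (hz i))
      have hsum : ∑ i, w i * (ω ⬝ᵥ x - ω ⬝ᵥ z i) = 0 := by
        have : ω ⬝ᵥ x = ∑ i, w i * (ω ⬝ᵥ z i) := by
          rw [← hxe, dotProduct_sum]
          simp [dotProduct_smul]
        simp_rw [mul_sub]
        rw [Finset.sum_sub_distrib, ← Finset.sum_mul, hw1, one_mul, ← this, sub_self]
      have := (Finset.sum_eq_zero_iff_of_nonneg (fun i _ =>
        mul_nonneg (hw0 i) (sub_nonneg.mpr (hle i)))).mp hsum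
      intro i hi
      have h := this i (Finset.mem_univ i)
      have h' := (mul_eq_zero.mp h).resolve_left hi
      exact mem_face_of_le hx (subset_convexHull ℝ S (hz i)) (by linarith)
    rw [← hxe]
    have : ∑ i, w i • z i = ∑ i ∈ Finset.univ.filter (fun i => w i ≠ 0), w i • z i := by
      rw [Finset.sum_filter]
      refine Finset.sum_congr rfl fun i _ => ?_
      by_cases h : w i = 0 <;> simp [h]
    rw [this]
    refine (convex_convexHull ℝ _).sum_mem (fun i _ => hw0 i) ?_ ?_
    · rw [← hw1, Finset.sum_filter]
      refine Finset.sum_congr rfl fun i _ => ?_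
      by_cases h : w i = 0 <;> simp [h]
    · intro i hi
      exact subset_convexHull ℝ _ ⟨hz i, key i (Finset.mem_filter.mp hi).2⟩
  · refine convexHull_min inter_subset_right (convex_face (convex_convexHull ℝ S) ω)

namespace IsRationalPolytope

theorem exists_finset {P : Set (Fin n → ℝ)} (hP : IsRationalPolytope P) :
    ∃ V : Finset (Fin n → ℝ), P = convexHull ℝ (V : Set (Fin n → ℝ)) := by
  classical
  obtain ⟨V, rfl⟩ := hP
  exact ⟨V.image fun v i => (v i : ℝ), by simp⟩

theorem face {P : Set (Fin n → ℝ)} (hP : IsRationalPolytope P) (ω : Fin n → ℝ) :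
    IsRationalPolytope (face P ω) := by
  classical
  obtain ⟨V, rfl⟩ := hP
  rw [face_convexHull]
  refine ⟨V.filter fun v => (fun i => (v i : ℝ)) ∈ StableVolume.face (convexHull ℝ
    ((fun v i => (v i : ℝ)) '' (V : Set (Fin n → ℚ)))) ω, ?_⟩
  congr 1
  ext x
  simp only [mem_inter_iff, mem_image, Finset.mem_coe, Finset.mem_filter]
  constructor
  · rintro ⟨⟨v, hv, rfl⟩, h⟩
    exact ⟨v, ⟨hv, h⟩, rfl⟩
  · rintro ⟨v, ⟨hv, h⟩, rfl⟩
    exact ⟨⟨v, hv, rfl⟩, h⟩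

theorem of_isFace {P F : Set (Fin n → ℝ)} (hP : IsRationalPolytope P) (h : IsFace P F) :
    IsRationalPolytope F := by
  obtain ⟨ω, rfl⟩ := h; exact hP.face ω

theorem convex {P : Set (Fin n → ℝ)} (hP : IsRationalPolytope P) : Convex ℝ P := by
  obtain ⟨V, rfl⟩ := hP; exact convex_convexHull ℝ _

theorem isCompact {P : Set (Fin n → ℝ)} (hP : IsRationalPolytope P) : IsCompact P := by
  obtain ⟨V, rfl⟩ := hP.exists_finset
  exact V.finite_toSet.isCompact_convexHull ℝ

theorem face_nonempty {P : Set (Fin n → ℝ)} (hP : IsRationalPolytope P) (hne : P.Nonempty)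
    (ω : Fin n → ℝ) : (StableVolume.face P ω).Nonempty := by
  obtain ⟨x, hx, h⟩ := hP.isCompact.exists_isMaxOn hne
    (f := fun x => ω ⬝ᵥ x) (Continuous.continuousOn (by fun_prop))
  exact ⟨x, hx, fun y hy => h hy⟩

theorem nonempty_of_isFace {P F : Set (Fin n → ℝ)} (hP : IsRationalPolytope P) (hne : P.Nonempty)
    (h : IsFace P F) : F.Nonempty := by
  obtain ⟨ω, rfl⟩ := h; exact hP.face_nonempty hne ω

theorem finite_faces {P : Set (Fin n → ℝ)} (hP : IsRationalPolytope P) :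
    {F | IsFace P F}.Finite := by
  obtain ⟨V, rfl⟩ := hP.exists_finset
  refine (V.finite_toSet.finite_subsets.image fun s => convexHull ℝ s).subset ?_
  rintro F ⟨ω, rfl⟩
  exact ⟨_, inter_subset_left, (face_convexHull _ ω).symm⟩

/-- Faces of faces are obtained by small perturbations of the functional. -/
theorem eventually_face_add_smul {P : Set (Fin n → ℝ)} (hP : IsRationalPolytope P)
    (hne : P.Nonempty) (ω u : Fin n → ℝ) :
    ∀ᶠ ε in 𝓝[>] (0 : ℝ),
      StableVolume.face P (ω + ε • u) = StableVolume.face (StableVolume.face P ω) u := by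
  obtain ⟨g, hg⟩ := (hP.face ω).face_nonempty (hP.face_nonempty hne ω) u
  obtain ⟨V, rfl⟩ := hP.exists_finset
  set P := convexHull ℝ (V : Set (Fin n → ℝ)) with hPV
  -- Generators off the face lose to `g` strictly under `ω`, hence also under small perturbations;
  -- there are finitely many of them. On the face `ω` is constant, so only `u` decides.
  have hev : ∀ᶠ ε in 𝓝[>] (0 : ℝ), ∀ x ∈ V, x ∉ StableVolume.face P ω →
      (ω + ε • u) ⬝ᵥ x < (ω + ε • u) ⬝ᵥ g := by
    rw [Finset.eventually_all]
    intro x hx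
    by_cases hxF : x ∈ StableVolume.face P ω
    · exact Eventually.of_forall fun ε h => absurd hxF h
    · have hlt : ω ⬝ᵥ x < ω ⬝ᵥ g := by
        by_contra hcon
        exact hxF (mem_face_of_le hg.1 (subset_convexHull ℝ _ hx) (not_lt.mp hcon))
      have hc : ∀ y : Fin n → ℝ, Continuous fun ε : ℝ => (ω + ε • u) ⬝ᵥ y := by
        intro y; fun_prop
      have := (isOpen_lt (hc x) (hc g)).mem_nhds (x := (0 : ℝ)) (by simpa using hlt)
      exact (Filter.Eventually.filter_mono nhdsWithin_le_nhds this).mono fun ε h _ => h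
  filter_upwards [hev, self_mem_nhdsWithin] with ε hε hpos
  have hpos : 0 < ε := hpos
  have hle : ∀ x ∈ V, (ω + ε • u) ⬝ᵥ x ≤ (ω + ε • u) ⬝ᵥ g := by
    intro x hx
    by_cases hxF : x ∈ StableVolume.face P ω
    · have h1 := dotProduct_eq_of_mem_face hxF hg.1
      have h2 := hg.2 x hxF
      simp only [add_dotProduct, smul_dotProduct, smul_eq_mul]
      rw [h1]; gcongr
    · exact (hε x hx hxF).le
  have hgm : g ∈ StableVolume.face P (ω + ε • u) := mem_face_convexHull hg.1.1 hle
  apply Subset.antisymm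
  · rw [hPV, face_convexHull]
    refine convexHull_min ?_ (convex_face (convex_face (convex_convexHull ℝ _) ω) u)
    rintro x ⟨hxV, hx⟩
    have heq := dotProduct_eq_of_mem_face hx hgm
    have hxF : x ∈ StableVolume.face P ω := by
      by_contra hcon
      exact (hε x hxV hcon).ne heq
    refine mem_face_of_le hg hxF ?_
    have h1 := dotProduct_eq_of_mem_face hxF hg.1
    simp only [add_dotProduct, smul_dotProduct, smul_eq_mul, h1] at heq
    have := mul_left_cancel₀ hpos.ne' (add_left_cancel heq)
    exact this.ge
  · intro x hx
    refine mem_face_of_le hgm hx.1.1 ?_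
    have h1 := dotProduct_eq_of_mem_face hx.1 hg.1
    have h2 := dotProduct_eq_of_mem_face hx hg
    simp [add_dotProduct, smul_dotProduct, h1, h2]

/-- If `ω` cuts out `F` and `u` cuts out `G` in `F`, then `ω + ε • u` cuts out `G` in `P` for small
`ε > 0`. -/
theorem isFace_trans {P F G : Set (Fin n → ℝ)} (hP : IsRationalPolytope P)
    (hne : P.Nonempty) (hF : IsFace P F) (hG : IsFace F G) : IsFace P G := by
  obtain ⟨ω, rfl⟩ := hF
  obtain ⟨u, rfl⟩ := hG
  obtain ⟨ε, hε⟩ := (hP.eventually_face_add_smul hne ω u).exists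
  exact ⟨_, hε.symm⟩

end IsRationalPolytope

theorem face_eq_face_of_subset {P F : Set (Fin n → ℝ)} {ω : Fin n → ℝ} (hFP : F ⊆ P)
    (hG : face P ω ⊆ F) (hne : (face P ω).Nonempty) : face P ω = face F ω := by
  obtain ⟨g, hg⟩ := hne
  exact Subset.antisymm (fun x hx => ⟨hG hx, fun y hy => hx.2 y (hFP hy)⟩)
    fun x hx => mem_face_of_le hg (hFP hx.1) (hx.2 g (hG hg))

theorem IsFace.of_subset {P F G : Set (Fin n → ℝ)} (hG : IsFace P G) (hne : G.Nonempty)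
    (hFP : F ⊆ P) (hGF : G ⊆ F) : IsFace F G := by
  obtain ⟨ω, rfl⟩ := hG
  exact ⟨ω, face_eq_face_of_subset hFP hGF hne⟩

/-- When both functionals attain their maxima at a common point, the maximum of the sum is the sum
of the maxima, so a maximizer of the sum maximizes each. -/
theorem face_add {P : Set (Fin n → ℝ)} {ω ω' : Fin n → ℝ}
    (h : (face P ω ∩ face P ω').Nonempty) : face P (ω + ω') = face P ω ∩ face P ω' := by
  obtain ⟨g, hg, hg'⟩ := h
  apply Subset.antisymm
  · intro x hx
    have h1 := hx.2 g hg.1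
    have h2 := hg.2 x hx.1
    have h3 := hg'.2 x hx.1
    simp only [add_dotProduct] at h1
    exact ⟨mem_face_of_le hg hx.1 (by linarith), mem_face_of_le hg' hx.1 (by linarith)⟩
  · intro x hx
    refine ⟨hx.1.1, fun y hy => ?_⟩
    have h1 := hx.1.2 y hy
    have h2 := hx.2.2 y hy
    simp only [add_dotProduct]
    linarith

theorem IsFace.inter {P F G : Set (Fin n → ℝ)} (hF : IsFace P F) (hG : IsFace P G)
    (h : (F ∩ G).Nonempty) : IsFace P (F ∩ G) := by
  obtain ⟨ω, rfl⟩ := hF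
  obtain ⟨ω', rfl⟩ := hG
  exact ⟨ω + ω', (face_add h).symm⟩

/-! ### Normal cones -/

theorem mem_normalCone {P F : Set (Fin n → ℝ)} {ω : Fin n → ℝ} :
    ω ∈ normalCone P F ↔ F ⊆ face P ω := Iff.rfl

theorem zero_mem_normalCone {P F : Set (Fin n → ℝ)} (h : F ⊆ P) : (0 : Fin n → ℝ) ∈ normalCone P F :=
  fun x hx => ⟨h hx, by simp⟩

theorem normalCone_anti {P F G : Set (Fin n → ℝ)} (h : F ⊆ G) : normalCone P G ⊆ normalCone P F :=
  fun _ hω => h.trans hω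

theorem add_mem_normalCone {P F : Set (Fin n → ℝ)} {ω ω' : Fin n → ℝ} (h : ω ∈ normalCone P F)
    (h' : ω' ∈ normalCone P F) : ω + ω' ∈ normalCone P F := by
  intro x hx
  refine ⟨(h hx).1, fun y hy => ?_⟩
  have h1 := (h hx).2 y hy
  have h2 := (h' hx).2 y hy
  simp only [add_dotProduct]
  linarith

theorem smul_mem_normalCone {P F : Set (Fin n → ℝ)} {ω : Fin n → ℝ} {c : ℝ} (hc : 0 ≤ c)
    (h : ω ∈ normalCone P F) : c • ω ∈ normalCone P F := by
  intro x hx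
  refine ⟨(h hx).1, fun y hy => ?_⟩
  have h1 := (h hx).2 y hy
  simp only [smul_dotProduct, smul_eq_mul]
  gcongr

theorem convex_normalCone (P F : Set (Fin n → ℝ)) : Convex ℝ (normalCone P F) :=
  fun _ hx _ hy _ _ ha hb _ =>
    add_mem_normalCone (smul_mem_normalCone ha hx) (smul_mem_normalCone hb hy)

theorem mem_link_iff {v u : Fin n → ℝ} {σ : Set (Fin n → ℝ)} :
    u ∈ link v σ ↔ ∀ᶠ ε in 𝓝[>] (0 : ℝ), v + ε • u ∈ σ := by
  rw [Filter.Eventually, mem_nhdsGT_iff_exists_Ioo_subset]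
  exact exists_congr fun δ => and_congr Iff.rfl
    ⟨fun h ε hε => h ε hε.1 hε.2, fun h ε h1 h2 => h ⟨h1, h2⟩⟩

/-- For small `ε > 0` the face of `P` selected by `ω + ε • u` is the face of `face P ω` selected by
`u`. This reduces every local computation at `ω` to the polytope `face P ω`. -/
theorem link_normalCone {P E : Set (Fin n → ℝ)} (hP : IsRationalPolytope P) (hne : P.Nonempty)
    (ω : Fin n → ℝ) : link ω (normalCone P E) = normalCone (face P ω) E := by
  ext u
  rw [mem_link_iff]
  have h := hP.eventually_face_add_smul hne ω u
  simp only [mem_normalCone]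
  constructor
  · intro h'
    obtain ⟨ε, h1, h2⟩ := (h.and h').exists
    rwa [← h1]
  · intro h'
    exact h.mono fun ε h1 => by rwa [h1]

theorem dualFace_normalCone {P F : Set (Fin n → ℝ)} (hF : IsFace P F) :
    dualFace P (normalCone P F) = F := by
  obtain ⟨ω, rfl⟩ := hF
  ext x
  exact ⟨fun h => h.2 ω fun _ h => h, fun h => ⟨h.1, fun ω' h' => h' h⟩⟩

theorem injOn_normalCone (P : Set (Fin n → ℝ)) : InjOn (normalCone P) {F | IsFace P F} :=
  fun F hF G hG h => by rw [← dualFace_normalCone hF, h, dualFace_normalCone hG]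

/-- Adding functionals in the cone intersects their faces, so among the finitely many faces cut out
by the cone a minimal one lies in all the others. With `normalCone_inter` this shows that normal
cones are closed under intersection. -/
theorem exists_isFace_normalCone_eq {P E : Set (Fin n → ℝ)} (hP : IsRationalPolytope P)
    (hE : E ⊆ P) (hne : E.Nonempty) : ∃ F, IsFace P F ∧ normalCone P E = normalCone P F := by
  let S : Set (Set (Fin n → ℝ)) := {F | ∃ ω ∈ normalCone P E, F = face P ω}
  have hS : S.Finite := hP.finite_faces.subset (by rintro F ⟨ω, -, rfl⟩; exact ⟨ω, rfl⟩)
  have hSne : S.Nonempty := ⟨_, 0, zero_mem_normalCone hE, rfl⟩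
  obtain ⟨F, ⟨⟨ω, hω, rfl⟩, hmin⟩⟩ := hS.exists_minimal hSne
  refine ⟨_, ⟨ω, rfl⟩, Subset.antisymm (fun ω' hω' => ?_) (normalCone_anti hω)⟩
  obtain ⟨e, he⟩ := hne
  have hadd : face P (ω + ω') = face P ω ∩ face P ω' := face_add ⟨e, hω he, hω' he⟩
  have := hmin ⟨_, add_mem_normalCone hω hω', rfl⟩ (hadd.trans_subset inter_subset_left)
  exact (this.trans hadd.subset).trans inter_subset_right

theorem normalCone_inter (P E F : Set (Fin n → ℝ)) :
    normalCone P E ∩ normalCone P F = normalCone P (E ∪ F) := by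
  ext ω; simp [mem_normalCone]

/-- From a relative interior point one can move slightly away from the functional `ω₀` defining `F`
and stay in the cone. A maximizer of `ω` outside `F` would be preferred to the points of `F` after
this move. -/
theorem face_eq_of_mem_intrinsicInterior {P F : Set (Fin n → ℝ)} (hF : IsFace P F)
    (hne : F.Nonempty) {ω : Fin n → ℝ} (hω : ω ∈ intrinsicInterior ℝ (normalCone P F)) :
    face P ω = F := by
  obtain ⟨ω₀, rfl⟩ := hF
  set C := normalCone P (face P ω₀)
  have hωC : ω ∈ C := intrinsicInterior_subset hω
  have hω₀ : ω₀ ∈ C := fun _ h => h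
  refine Subset.antisymm (fun x hx => ?_) hωC
  have hline : ∀ ε : ℝ, ω + ε • (ω - ω₀) ∈ affineSpan ℝ C := by
    intro ε
    have := (affineSpan ℝ C).smul_vsub_vadd_mem ε (subset_affineSpan ℝ C hωC)
      (subset_affineSpan ℝ C hω₀) (subset_affineSpan ℝ C hωC)
    simpa [add_comm] using this
  obtain ⟨y, hy, rfl⟩ := mem_intrinsicInterior.mp hω
  let g : ℝ → affineSpan ℝ C := fun ε => ⟨y + ε • (y - ω₀), hline ε⟩
  have hg : Continuous g := by
    apply Continuous.subtype_mk; fun_prop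
  have hg0 : g 0 = y := by ext; simp [g]
  have : ∀ᶠ ε in 𝓝 (0 : ℝ), g ε ∈ interior (((↑) : affineSpan ℝ C → _) ⁻¹' C) :=
    hg.continuousAt.preimage_mem_nhds (isOpen_interior.mem_nhds (by rw [hg0]; exact hy))
  obtain ⟨ε, hε, hpos⟩ := (this.filter_mono nhdsWithin_le_nhds |>.and
    (self_mem_nhdsWithin : ∀ᶠ ε in 𝓝[>] (0 : ℝ), ε ∈ Ioi (0 : ℝ))).exists
  have hpos : 0 < ε := hpos
  have hmem : (y : Fin n → ℝ) + ε • (y - ω₀) ∈ C := by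
    have h := interior_subset hε
    exact h
  obtain ⟨f, hf⟩ := hne
  have h1 := (hmem hf).2 x hx.1
  have h2 := dotProduct_eq_of_mem_face hx (hωC hf)
  simp only [add_dotProduct, smul_dotProduct, sub_dotProduct, smul_eq_mul, h2] at h1
  refine mem_face_of_le hf hx.1 ?_
  by_contra hcon
  nlinarith

/-! ### Orthogonal complements and dimensions -/

/-- The orthogonal complement with respect to the dot product. -/
noncomputable def perp (W : Submodule ℝ (Fin n → ℝ)) : Submodule ℝ (Fin n → ℝ) :=
  W.dualAnnihilator.comap (dotProductEquiv ℝ (Fin n)).toLinearMap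

theorem mem_perp {W : Submodule ℝ (Fin n → ℝ)} {ω : Fin n → ℝ} :
    ω ∈ perp W ↔ ∀ x ∈ W, ω ⬝ᵥ x = 0 := by
  simp [perp, Submodule.mem_dualAnnihilator]

theorem finrank_add_finrank_perp (W : Submodule ℝ (Fin n → ℝ)) :
    Module.finrank ℝ W + Module.finrank ℝ (perp W) = n := by
  have h1 : Module.finrank ℝ (perp W) = Module.finrank ℝ W.dualAnnihilator := by
    rw [perp, Submodule.comap_equiv_eq_map_symm]
    exact LinearEquiv.finrank_map_eq _ _
  rw [h1, Subspace.finrank_add_finrank_dualAnnihilator_eq, Module.finrank_fin_fun]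

theorem sub_mem_vectorSpan {F : Set (Fin n → ℝ)} {x y : Fin n → ℝ} (hx : x ∈ F) (hy : y ∈ F) :
    x - y ∈ vectorSpan ℝ F :=
  vsub_mem_vectorSpan ℝ hx hy

theorem vectorSpan_le_iff {F : Set (Fin n → ℝ)} {W : Submodule ℝ (Fin n → ℝ)} :
    vectorSpan ℝ F ≤ W ↔ ∀ x ∈ F, ∀ y ∈ F, x - y ∈ W := by
  rw [vectorSpan_def, Submodule.span_le]
  constructor
  · intro h x hx y hy; exact h ⟨x, hx, y, hy, rfl⟩
  · rintro h _ ⟨x, hx, y, hy, rfl⟩; exact h x hx y hy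

theorem mem_perp_vectorSpan {F : Set (Fin n → ℝ)} {ω : Fin n → ℝ} :
    ω ∈ perp (vectorSpan ℝ F) ↔ ∀ x ∈ F, ∀ y ∈ F, ω ⬝ᵥ x = ω ⬝ᵥ y := by
  constructor
  · intro h x hx y hy
    have := mem_perp.mp h _ (sub_mem_vectorSpan hx hy)
    rw [dotProduct_sub] at this
    linarith
  · intro h
    have : vectorSpan ℝ F ≤ LinearMap.ker (dotProductEquiv ℝ (Fin n) ω) := by
      rw [vectorSpan_le_iff]
      intro x hx y hy
      simp [dotProduct_sub, h x hx y hy]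
    rw [mem_perp]
    intro x hx
    simpa using this hx

theorem normalCone_subset_perp (P F : Set (Fin n → ℝ)) :
    normalCone P F ⊆ perp (vectorSpan ℝ F) :=
  fun _ hω => mem_perp_vectorSpan.mpr fun _ hx _ hy => dotProduct_eq_of_mem_face (hω hx) (hω hy)

theorem normalCone_self (F : Set (Fin n → ℝ)) : normalCone F F = perp (vectorSpan ℝ F) := by
  refine Subset.antisymm (normalCone_subset_perp F F) fun ω hω x hx => ⟨hx, fun y hy => ?_⟩
  exact (mem_perp_vectorSpan.mp hω y hy x hx).le

/-- A functional constant on `F` does not affect comparisons within `F`: it belongs to the lineality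
space of the normal fan of `F`. -/
theorem add_mem_normalCone_iff {F E : Set (Fin n → ℝ)} {ω l : Fin n → ℝ} (hE : E ⊆ F)
    (hl : l ∈ perp (vectorSpan ℝ F)) : ω + l ∈ normalCone F E ↔ ω ∈ normalCone F E := by
  have h : ∀ {l}, l ∈ perp (vectorSpan ℝ F) → l ∈ normalCone F E := fun {l} hl =>
    normalCone_anti hE (by rw [normalCone_self]; exact hl)
  refine ⟨fun h' => ?_, fun h' => add_mem_normalCone h' (h hl)⟩
  simpa using add_mem_normalCone h' (h (neg_mem hl))

/-- At a functional `ω` defining `F`, the link of the cone is already the whole orthogonal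
complement, so the cone contains `ω + ε • u` for every `u` in it and small `ε > 0`. -/
theorem vectorSpan_normalCone {P F : Set (Fin n → ℝ)} (hP : IsRationalPolytope P)
    (hne : P.Nonempty) (hF : IsFace P F) :
    vectorSpan ℝ (normalCone P F) = perp (vectorSpan ℝ F) := by
  apply le_antisymm
  · rw [vectorSpan_le_iff]
    exact fun x hx y hy => sub_mem (normalCone_subset_perp P F hx) (normalCone_subset_perp P F hy)
  · obtain ⟨ω, rfl⟩ := hF
    intro u hu
    have : u ∈ link ω (normalCone P (face P ω)) := by
      rw [link_normalCone hP hne, normalCone_self]; exact hu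
    rw [mem_link_iff] at this
    obtain ⟨ε, hε, hpos⟩ := (this.and self_mem_nhdsWithin).exists
    have hpos : 0 < ε := hpos
    have hω : ω ∈ normalCone P (face P ω) := fun _ h => h
    have h := sub_mem_vectorSpan hε hω
    rw [add_sub_cancel_left] at h
    exact (Submodule.smul_mem_iff _ hpos.ne').mp h

theorem dim_normalCone_add {P F : Set (Fin n → ℝ)} (hP : IsRationalPolytope P)
    (hne : P.Nonempty) (hF : IsFace P F) : dim (normalCone P F) + dim F = n := by
  rw [dim, dim, vectorSpan_normalCone hP hne hF, add_comm]
  exact finrank_add_finrank_perp _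

theorem dim_mono {F G : Set (Fin n → ℝ)} (h : F ⊆ G) : dim F ≤ dim G :=
  Submodule.finrank_mono (vectorSpan_mono ℝ h)

theorem subsingleton_of_dim_eq_zero {F : Set (Fin n → ℝ)} (h : dim F = 0) : F.Subsingleton := by
  rw [dim, Submodule.finrank_eq_zero] at h
  exact vectorSpan_eq_bot_iff_subsingleton ℝ |>.mp h

/-- If the two spans agreed, the functional defining `H` would be constant on `F`, forcing `H = F`.
-/
theorem IsFace.dim_lt {F H : Set (Fin n → ℝ)} (hH : IsFace F H) (hne : H.Nonempty)
    (h : H ≠ F) : dim H < dim F := by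
  obtain ⟨x, hxF, hxH⟩ : ∃ x ∈ F, x ∉ H := by
    by_contra! hcon
    exact h (Subset.antisymm hH.subset hcon)
  obtain ⟨y, hy⟩ := hne
  refine Submodule.finrank_lt_finrank_of_lt (lt_of_le_of_ne (vectorSpan_mono ℝ hH.subset) ?_)
  intro heq
  have hmem : x - y ∈ vectorSpan ℝ H := heq ▸ sub_mem_vectorSpan hxF (hH.subset hy)
  obtain ⟨ω, rfl⟩ := hH
  have hω : ω ∈ perp (vectorSpan ℝ (face F ω)) :=
    normalCone_subset_perp F (face F ω) fun _ h => h
  have := mem_perp.mp hω _ hmem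
  rw [dotProduct_sub] at this
  exact hxH (mem_face_of_le hy hxF (by linarith))

/-! ### Lattices of rational polytopes -/

@[simp] theorem intVec_apply (v : Fin n → ℤ) (i : Fin n) : intVec n v i = (v i : ℝ) := rfl

theorem intVec_dotProduct_intVec (u v : Fin n → ℤ) :
    intVec n u ⬝ᵥ intVec n v = ((u ⬝ᵥ v : ℤ) : ℝ) := by
  simp [dotProduct]

theorem mem_lattice {s : Set (Fin n → ℝ)} {z : Fin n → ℤ} :
    z ∈ lattice s ↔ intVec n z ∈ vectorSpan ℝ s := Iff.rfl

theorem lattice_mono {s t : Set (Fin n → ℝ)} (h : s ⊆ t) : lattice s ≤ lattice t :=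
  fun _ hz => vectorSpan_mono ℝ h hz

theorem exists_int_smul_eq_intVec (v : Fin n → ℚ) :
    ∃ (N : ℤ) (z : Fin n → ℤ), N ≠ 0 ∧ intVec n z = (N : ℝ) • fun i => (v i : ℝ) := by
  obtain ⟨⟨N, hN⟩, h⟩ := IsLocalization.exist_integer_multiples_of_finite (nonZeroDivisors ℤ) v
  choose z hz using h
  refine ⟨N, z, nonZeroDivisors.ne_zero hN, ?_⟩
  ext i
  have := hz i
  simp only [eq_intCast, zsmul_eq_mul] at this
  have h2 : ((z i : ℚ) : ℝ) = ((N * v i : ℚ) : ℝ) := by rw [this]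
  simpa using h2

/-- Rationality enters here: differences of rational generators become lattice vectors after
clearing denominators. -/
theorem IsRationalPolytope.span_lattice {P : Set (Fin n → ℝ)} (hP : IsRationalPolytope P) :
    Submodule.span ℝ (intVec n '' (lattice P : Set (Fin n → ℤ))) = vectorSpan ℝ P := by
  apply le_antisymm
  · rw [Submodule.span_le]
    rintro _ ⟨z, hz, rfl⟩
    exact hz
  · have hsub : ∀ w ∈ vectorSpan ℝ P, ∀ v : Fin n → ℚ, w = (fun i => (v i : ℝ)) →
        w ∈ Submodule.span ℝ (intVec n '' (lattice P : Set (Fin n → ℤ))) := by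
      rintro _ hw v rfl
      obtain ⟨N, z, hN, hz⟩ := exists_int_smul_eq_intVec v
      have hzP : z ∈ lattice P := by
        rw [mem_lattice, hz]; exact Submodule.smul_mem _ _ hw
      have : intVec n z ∈ Submodule.span ℝ (intVec n '' (lattice P : Set (Fin n → ℤ))) :=
        Submodule.subset_span ⟨z, hzP, rfl⟩
      rw [hz] at this
      exact (Submodule.smul_mem_iff _ (by exact_mod_cast hN)).mp this
    obtain ⟨V, hV⟩ := hP
    have hspan : vectorSpan ℝ P = vectorSpan ℝ
        ((fun (v : Fin n → ℚ) i => (v i : ℝ)) '' (V : Set (Fin n → ℚ))) := by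
      rw [hV, ← direction_affineSpan, affineSpan_convexHull, direction_affineSpan]
    rw [hspan, vectorSpan_le_iff]
    rintro _ ⟨v, hv, rfl⟩ _ ⟨w, hw, rfl⟩
    refine hsub _ ?_ (v - w) (by ext i; simp)
    rw [hspan]
    exact sub_mem_vectorSpan ⟨v, hv, rfl⟩ ⟨w, hw, rfl⟩

/-- The real span of integer vectors, as a linear map in the coefficients. -/
noncomputable def latticeMap {k : ℕ} (b : Fin k → Fin n → ℤ) : (Fin k → ℝ) →ₗ[ℝ] (Fin n → ℝ) :=
  Fintype.linearCombination ℝ fun i => intVec n (b i)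

theorem latticeMap_apply {k : ℕ} (b : Fin k → Fin n → ℤ) (x : Fin k → ℝ) :
    latticeMap b x = ∑ i, x i • intVec n (b i) := rfl

theorem latticeMap_injective {k : ℕ} {L : Submodule ℤ (Fin n → ℤ)} (b : Module.Basis (Fin k) ℤ L) :
    Function.Injective (latticeMap fun i => (b i : Fin n → ℤ)) := by
  have h : LinearIndependent ℤ fun i => (b i : Fin n → ℤ) :=
    b.linearIndependent.map' L.subtype (Submodule.ker_subtype _)
  exact (linearIndependent_algebraMap_comp_iff (S := ℝ)).mpr h
    |>.fintypeLinearCombination_injective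

theorem range_latticeMap {k : ℕ} {L : Submodule ℤ (Fin n → ℤ)} (b : Module.Basis (Fin k) ℤ L) :
    LinearMap.range (latticeMap fun i => (b i : Fin n → ℤ)) =
      Submodule.span ℝ (intVec n '' (L : Set (Fin n → ℤ))) := by
  rw [latticeMap, Fintype.range_linearCombination]
  apply le_antisymm
  · apply Submodule.span_mono
    rintro _ ⟨i, rfl⟩
    exact ⟨_, (b i).2, rfl⟩
  · rw [Submodule.span_le]
    rintro _ ⟨z, hz, rfl⟩
    have := b.sum_repr ⟨z, hz⟩
    have h2 := congrArg (fun w : L => intVec n (w : Fin n → ℤ)) this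
    simp only [Submodule.coe_sum, map_sum] at h2
    rw [← h2]
    refine Submodule.sum_mem _ fun i _ => ?_
    rw [Submodule.coe_smul, map_smul, ← Int.cast_smul_eq_zsmul ℝ]
    exact Submodule.smul_mem _ _ (Submodule.subset_span ⟨i, rfl⟩)

theorem IsRationalPolytope.range_latticeMap {P : Set (Fin n → ℝ)} (hP : IsRationalPolytope P)
    {k : ℕ} (b : Module.Basis (Fin k) ℤ (lattice P)) :
    LinearMap.range (latticeMap fun i => (b i : Fin n → ℤ)) = vectorSpan ℝ P := by
  rw [StableVolume.range_latticeMap, hP.span_lattice]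

theorem IsRationalPolytope.dim_eq_of_basis {P : Set (Fin n → ℝ)} (hP : IsRationalPolytope P)
    {k : ℕ} (b : Module.Basis (Fin k) ℤ (lattice P)) : dim P = k := by
  rw [dim, ← hP.range_latticeMap b, LinearMap.finrank_range_of_inj (latticeMap_injective b),
    Module.finrank_fin_fun]

theorem IsRationalPolytope.exists_basis {P : Set (Fin n → ℝ)} (hP : IsRationalPolytope P) {k : ℕ}
    (hk : dim P = k) : Nonempty (Module.Basis (Fin k) ℤ (lattice P)) := by
  have b := Module.finBasis ℤ (lattice P)
  rw [← hP.dim_eq_of_basis b, hk] at b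
  exact ⟨b⟩

/-- Lebesgue measure of `S` in the affine coordinates given by the point `p` and the vectors
`b i`. -/
noncomputable def coordVolume {k : ℕ} (p : Fin n → ℝ) (b : Fin k → Fin n → ℤ)
    (S : Set (Fin n → ℝ)) : ENNReal :=
  volume {x : Fin k → ℝ | p + latticeMap b x ∈ S}

/-- The change of basis is unimodular and the change of base point is a translation in coordinates;
both preserve Lebesgue measure. -/
theorem coordVolume_eq {k : ℕ} {L : Submodule ℤ (Fin n → ℤ)} (b b' : Module.Basis (Fin k) ℤ L)
    {p p' : Fin n → ℝ} (hp : p' - p ∈ Submodule.span ℝ (intVec n '' (L : Set (Fin n → ℤ))))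
    (S : Set (Fin n → ℝ)) :
    coordVolume p' (fun i => (b' i : Fin n → ℤ)) S = coordVolume p (fun i => (b i : Fin n → ℤ)) S := by
  let A := b.toMatrix b'
  have hdet : IsUnit A.det := b.isUnit_det b'
  let M : (Fin k → ℝ) →ₗ[ℝ] (Fin k → ℝ) := Matrix.toLin' (A.map (Int.cast : ℤ → ℝ))
  have hM : LinearMap.det M = (A.det : ℝ) := by
    rw [LinearMap.det_toLin']
    exact ((Int.castRingHom ℝ).map_det A).symm
  have habs : |LinearMap.det M| = 1 := by
    rw [hM]
    rcases Int.isUnit_iff.mp hdet with h | h <;> simp [h]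
  have hcomp : ∀ x, latticeMap (fun i => (b' i : Fin n → ℤ)) x =
      latticeMap (fun i => (b i : Fin n → ℤ)) (M x) := by
    intro x
    have hb : ∀ j, intVec n (b' j) = ∑ i, (A i j : ℝ) • intVec n (b i) := by
      intro j
      have h := b.sum_toMatrix_smul_self b' j
      have h2 := congrArg (fun w : L => intVec n (w : Fin n → ℤ)) h
      simp only [Submodule.coe_sum, map_sum] at h2
      rw [← h2]
      refine Finset.sum_congr rfl fun i _ => ?_
      rw [Submodule.coe_smul, map_smul, ← Int.cast_smul_eq_zsmul ℝ]
    simp only [latticeMap_apply, hb, M, Matrix.toLin'_apply, Matrix.mulVec, dotProduct,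
      Matrix.map_apply, Finset.smul_sum, Finset.sum_smul, smul_smul]
    rw [Finset.sum_comm]
    simp_rw [mul_comm]
  rw [← range_latticeMap b] at hp
  obtain ⟨z, hz⟩ := hp
  unfold coordVolume
  have h1 : {x : Fin k → ℝ | p' + latticeMap (fun i => (b' i : Fin n → ℤ)) x ∈ S} =
      M ⁻¹' ((fun y => z + y) ⁻¹' {x | p + latticeMap (fun i => (b i : Fin n → ℤ)) x ∈ S}) := by
    ext x
    simp only [mem_ofPred_eq, mem_preimage, map_add, hz, hcomp]
    rw [← add_assoc, add_sub_cancel]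
  have h0 : LinearMap.det M ≠ 0 := by
    intro h; rw [h] at habs; simp at habs
  rw [h1, Measure.addHaar_preimage_linearMap _ h0, abs_inv, habs, measure_preimage_add]
  simp

theorem IsRationalPolytope.normalizedVolume_eq {P : Set (Fin n → ℝ)} (hP : IsRationalPolytope P)
    {k : ℕ} (b : Module.Basis (Fin k) ℤ (lattice P)) {p q : Fin n → ℝ} (hq : q ∈ P)
    (hp : p - q ∈ vectorSpan ℝ P) :
    normalizedVolume P =
      (k.factorial : ℝ) * (coordVolume p (fun i => (b i : Fin n → ℤ)) P).toReal := by
  have hk := hP.dim_eq_of_basis b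
  have hk' := hP.dim_eq_of_basis (Module.finBasis ℤ (lattice P))
  have hne : P.Nonempty := ⟨q, hq⟩
  obtain rfl : k = Module.finrank ℤ (lattice P) := hk.symm.trans hk'
  rw [normalizedVolume, dif_pos hne, hk']
  congr 2
  symm
  apply coordVolume_eq
  rw [hP.span_lattice, ← sub_add_sub_cancel p q]
  exact add_mem hp (sub_mem_vectorSpan hq hne.some_mem)

/-! ### Facets and their primitive normals -/

/-- Integral functionals on the saturated lattice of a set extend to `ℤⁿ`. -/
theorem exists_dotProduct_eq {s : Set (Fin n → ℝ)} (φ : lattice s →ₗ[ℤ] ℤ) :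
    ∃ u : Fin n → ℤ, ∀ z : lattice s, u ⬝ᵥ (z : Fin n → ℤ) = φ z := by
  let g : (Fin n → ℤ) →ₗ[ℤ] ((Fin n → ℝ) ⧸ vectorSpan ℝ s) :=
    ((vectorSpan ℝ s).mkQ.restrictScalars ℤ) ∘ₗ intVec n
  have hg : ∀ z, g z = 0 ↔ z ∈ lattice s := by
    intro z
    simp [g, mem_lattice]
  have : Module.IsTorsionFree ℤ ((Fin n → ℝ) ⧸ vectorSpan ℝ s) :=
    Module.IsTorsionFree.trans_faithfulSMul ℤ ℝ _
  have : Module.Finite ℤ (LinearMap.range g) := Module.Finite.range g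
  -- The image of `ℤⁿ` in the real quotient is finitely generated and torsion-free, hence
  -- projective. So `g` splits, its kernel `lattice s` is a direct summand, and `φ` extends through
  -- the projection `π`.
  obtain ⟨σ, hσ⟩ := Module.projective_lifting_property g.rangeRestrict LinearMap.id
    g.surjective_rangeRestrict
  have hσ' : ∀ z, g (σ (g.rangeRestrict z)) = g z := fun z =>
    congrArg Subtype.val (LinearMap.congr_fun hσ (g.rangeRestrict z))
  let π : (Fin n → ℤ) →ₗ[ℤ] lattice s :=
    (LinearMap.id - σ ∘ₗ g.rangeRestrict).codRestrict (lattice s) fun z => by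
      rw [← hg]; simp [hσ']
  have hπ : ∀ z : lattice s, π z = z := by
    intro z
    ext1
    have : g.rangeRestrict (z : Fin n → ℤ) = 0 := Subtype.ext ((hg z).mpr z.2)
    simp [π, this]
  refine ⟨(dotProductEquiv ℤ (Fin n)).symm (φ ∘ₗ π), fun z => ?_⟩
  have h := LinearMap.congr_fun ((dotProductEquiv ℤ (Fin n)).apply_symm_apply (φ ∘ₗ π)) z
  rw [LinearMap.comp_apply, hπ] at h
  exact h

theorem mem_perp_iff_of_lattice {F : Set (Fin n → ℝ)} (hF : IsRationalPolytope F)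
    {ω : Fin n → ℝ} :
    ω ∈ perp (vectorSpan ℝ F) ↔ ∀ z ∈ lattice F, ω ⬝ᵥ intVec n z = 0 := by
  refine ⟨fun h z hz => mem_perp.mp h _ hz, fun h => mem_perp.mpr fun x hx => ?_⟩
  have : vectorSpan ℝ F ≤ LinearMap.ker (dotProductEquiv ℝ (Fin n) ω) := by
    rw [← hF.span_lattice, Submodule.span_le]
    rintro _ ⟨z, hz, rfl⟩
    simpa using h z hz
  simpa using this hx

/-- The pair `(u, c)` of an outer primitive normal vector `u` of the facet `G` of `F` and a
lattice vector `c` of height one. -/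
structure IsFacetNormal (F G : Set (Fin n → ℝ)) (u c : Fin n → ℤ) : Prop where
  eq_face : G = face F (intVec n u)
  mem_lattice : c ∈ lattice F
  dotProduct_eq_one : u ⬝ᵥ c = 1
  sub_mem : ∀ z ∈ lattice F, z - (u ⬝ᵥ z) • c ∈ lattice G

/-- The functional `ω` defining `G` may be irrational, but on `lattice F` its kernel `lattice G` has
corank one, so its values form an infinite cyclic group. Identifying this group with `ℤ` yields an
integral functional, extended to `u`, and `c` is a preimage of `1`. -/
theorem exists_isFacetNormal {F G : Set (Fin n → ℝ)} (hF : IsRationalPolytope F)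
    (hne : F.Nonempty) (hG : IsFace F G) (hdim : dim G + 1 = dim F) :
    ∃ u c, IsFacetNormal F G u c := by
  have hGr := hF.of_isFace hG
  have hGF := hG.subset
  have hGne := hF.nonempty_of_isFace hne hG
  obtain ⟨ω, rfl⟩ := hG
  have hωG : ω ∈ perp (vectorSpan ℝ (face F ω)) :=
    normalCone_subset_perp F (face F ω) fun _ h => h
  let f : lattice F →ₗ[ℤ] ℝ :=
    ((dotProductEquiv ℝ (Fin n) ω).restrictScalars ℤ) ∘ₗ intVec n ∘ₗ (lattice F).subtype
  have hf : ∀ z, f z = ω ⬝ᵥ intVec n z := fun z => rfl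
  have hspan : vectorSpan ℝ (face F ω) =
      vectorSpan ℝ F ⊓ LinearMap.ker (dotProductEquiv ℝ (Fin n) ω) := by
    apply Submodule.eq_of_le_of_finrank_le
    · refine le_inf (vectorSpan_mono ℝ hGF) fun x hx => ?_
      simpa using mem_perp.mp hωG x hx
    · have hlt : vectorSpan ℝ F ⊓ LinearMap.ker (dotProductEquiv ℝ (Fin n) ω) <
          vectorSpan ℝ F := by
        refine lt_of_le_of_ne inf_le_left fun heq => ?_
        have hω : ω ∈ perp (vectorSpan ℝ F) := mem_perp.mpr fun x hx => by
          rw [← heq] at hx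
          simpa using hx.2
        have : face F ω = F := by
          refine Subset.antisymm hGF fun x hx => ⟨hx, fun y hy => ?_⟩
          exact (mem_perp_vectorSpan.mp hω y hy x hx).le
        rw [this] at hdim
        omega
      have := Submodule.finrank_lt_finrank_of_lt hlt
      change _ ≤ dim (face F ω)
      change _ < dim F at this
      omega
  have hmem : ∀ z : lattice F, f z = 0 ↔ (z : Fin n → ℤ) ∈ lattice (face F ω) := by
    intro z
    rw [mem_lattice, hspan, Submodule.mem_inf, hf]
    exact ⟨fun h => ⟨z.2, by simpa using h⟩, fun h => by simpa using h.2⟩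
  have hker : Module.finrank ℤ (LinearMap.ker f) = Module.finrank ℤ (lattice (face F ω)) := by
    have : LinearMap.ker f = (lattice (face F ω)).comap (lattice F).subtype := by
      ext z; simp [hmem]
    rw [this]
    exact (Submodule.comapSubtypeEquivOfLe (lattice_mono hGF)).finrank_eq
  have hrange : Module.finrank ℤ (LinearMap.range f) = 1 := by
    have h1 := Submodule.finrank_quotient_add_finrank (LinearMap.ker f)
    rw [f.quotKerEquivRange.finrank_eq] at h1
    have h2 := hF.dim_eq_of_basis (Module.finBasis ℤ (lattice F))
    have h3 := hGr.dim_eq_of_basis (Module.finBasis ℤ (lattice (face F ω)))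
    omega
  obtain ⟨e⟩ : Nonempty (LinearMap.range f ≃ₗ[ℤ] ℤ) :=
    ⟨LinearEquiv.ofFinrankEq _ _ (by rw [hrange, Module.finrank_self])⟩
  let φ : lattice F →ₗ[ℤ] ℤ := e.toLinearMap ∘ₗ f.rangeRestrict
  have hφ : ∀ z, φ z = 0 ↔ f z = 0 := by
    intro z
    simp only [φ, LinearMap.comp_apply, LinearEquiv.coe_coe, LinearEquiv.map_eq_zero_iff]
    exact Subtype.ext_iff
  obtain ⟨c, hc⟩ : ∃ c, φ c = 1 := (e.surjective.comp f.surjective_rangeRestrict) 1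
  obtain ⟨u, hu⟩ := exists_dotProduct_eq φ
  have hsub : ∀ z ∈ lattice F, z - (u ⬝ᵥ z) • (c : Fin n → ℤ) ∈ lattice (face F ω) := by
    intro z hz
    have h : φ (⟨z, hz⟩ - φ ⟨z, hz⟩ • c) = 0 := by simp [hc]
    rw [hφ, hmem, ← hu] at h
    exact h
  have hωc : ω ⬝ᵥ intVec n c ≠ 0 := by
    intro h
    rw [← hf, ← hφ, hc] at h
    exact one_ne_zero h
  -- On `F`, up to an additive constant, `ω` is the multiple `ω ⬝ᵥ intVec n c` of `u`.
  have hprop : ∀ x ∈ F, ∀ y ∈ F, ω ⬝ᵥ x - ω ⬝ᵥ y =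
      (ω ⬝ᵥ intVec n c) * (intVec n u ⬝ᵥ x - intVec n u ⬝ᵥ y) := by
    have : ω - (ω ⬝ᵥ intVec n c) • intVec n u ∈ perp (vectorSpan ℝ F) := by
      rw [mem_perp_iff_of_lattice hF]
      intro z hz
      have h := mem_perp.mp hωG _ (hsub z hz)
      rw [map_sub, map_smul, ← Int.cast_smul_eq_zsmul ℝ, dotProduct_sub, dotProduct_smul,
        smul_eq_mul] at h
      rw [sub_dotProduct, smul_dotProduct, intVec_dotProduct_intVec, smul_eq_mul]
      linarith
    intro x hx y hy
    have h := mem_perp_vectorSpan.mp this x hx y hy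
    simp only [sub_dotProduct, smul_dotProduct, smul_eq_mul] at h
    linarith
  -- The identification with `ℤ` is unique only up to sign; the sign is chosen to make the normal
  -- outer.
  rcases lt_or_gt_of_ne hωc with hneg | hpos
  · refine ⟨-u, -c, ?_, neg_mem c.2, ?_, ?_⟩
    · ext x
      refine and_congr_right fun hx => forall₂_congr fun y hy => ?_
      rw [map_neg, neg_dotProduct, neg_dotProduct, neg_le_neg_iff]
      have := hprop x hx y hy
      constructor <;> intro h <;> nlinarith
    · rw [neg_dotProduct, dotProduct_neg, neg_neg, hu, hc]
    · intro z hz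
      have := hsub z hz
      rwa [neg_dotProduct, neg_smul, smul_neg, neg_neg]
  · refine ⟨u, c, ?_, c.2, by rw [hu, hc], hsub⟩
    ext x
    refine and_congr_right fun hx => forall₂_congr fun y hy => ?_
    have := hprop x hx y hy
    constructor <;> intro h <;> nlinarith

namespace IsFacetNormal

variable {F G : Set (Fin n → ℝ)} {u c : Fin n → ℤ}

theorem isFace (h : IsFacetNormal F G u c) : IsFace F G := ⟨_, h.eq_face⟩

theorem mem_normalCone (h : IsFacetNormal F G u c) : intVec n u ∈ normalCone F G :=
  h.eq_face.subset

theorem mem_perp (h : IsFacetNormal F G u c) : intVec n u ∈ perp (vectorSpan ℝ G) :=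
  normalCone_subset_perp F G h.mem_normalCone

theorem intVec_dotProduct (h : IsFacetNormal F G u c) : intVec n u ⬝ᵥ intVec n c = 1 := by
  rw [intVec_dotProduct_intVec, h.dotProduct_eq_one, Int.cast_one]

/-- Functionals orthogonal to a facet are multiples of its normal. -/
theorem sub_smul_mem_perp (h : IsFacetNormal F G u c) (hF : IsRationalPolytope F)
    {ω : Fin n → ℝ} (hω : ω ∈ perp (vectorSpan ℝ G)) :
    ω - (ω ⬝ᵥ intVec n c) • intVec n u ∈ perp (vectorSpan ℝ F) := by
  rw [mem_perp_iff_of_lattice hF]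
  intro z hz
  have h := StableVolume.mem_perp.mp hω _ (h.sub_mem z hz)
  rw [map_sub, map_smul, ← Int.cast_smul_eq_zsmul ℝ, dotProduct_sub, dotProduct_smul,
    smul_eq_mul] at h
  rw [sub_dotProduct, smul_dotProduct, intVec_dotProduct_intVec, smul_eq_mul]
  linarith

/-- The normal cone of a facet is a ray, up to lineality. -/
theorem mem_normalCone_iff (h : IsFacetNormal F G u c) (hF : IsRationalPolytope F)
    (hG : G ≠ F) {ω : Fin n → ℝ} (hne : G.Nonempty) :
    ω ∈ normalCone F G ↔ ∃ t : ℝ, 0 ≤ t ∧ ω - t • intVec n u ∈ perp (vectorSpan ℝ F) := by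
  constructor
  · intro hω
    have h1 := h.sub_smul_mem_perp hF (normalCone_subset_perp F G hω)
    refine ⟨_, ?_, h1⟩
    obtain ⟨x, hxF, hxG⟩ : ∃ x ∈ F, x ∉ G := by
      by_contra! hcon
      exact hG (Subset.antisymm h.isFace.subset hcon)
    obtain ⟨g, hg⟩ := hne
    have hgu := h.mem_normalCone hg
    have hlt : intVec n u ⬝ᵥ x < intVec n u ⬝ᵥ g := by
      by_contra hcon
      exact hxG (h.eq_face ▸ mem_face_of_le hgu hxF (not_lt.mp hcon))
    have h2 := mem_perp_vectorSpan.mp h1 x hxF g hgu.1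
    have h3 := (hω hg).2 x hxF
    simp only [sub_dotProduct, smul_dotProduct, smul_eq_mul] at h2
    by_contra hcon
    nlinarith
  · rintro ⟨t, ht, hω⟩
    have := (add_mem_normalCone_iff h.isFace.subset hω).mpr
      (smul_mem_normalCone ht h.mem_normalCone)
    simpa using this

end IsFacetNormal

theorem mem_lattice_normalCone {P F : Set (Fin n → ℝ)} (hP : IsRationalPolytope P)
    (hne : P.Nonempty) (hF : IsFace P F) {z : Fin n → ℤ} :
    z ∈ lattice (normalCone P F) ↔ ∀ w ∈ lattice F, z ⬝ᵥ w = 0 := by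
  rw [mem_lattice, vectorSpan_normalCone hP hne hF, mem_perp_iff_of_lattice (hP.of_isFace hF)]
  simp only [intVec_dotProduct_intVec, Int.cast_eq_zero]

/-- Lattice index of the normal cones of an edge and a facet of a face `F` of `P`. -/
theorem latticeIndex_normalCone {P F E G : Set (Fin n → ℝ)} (hP : IsRationalPolytope P)
    (hne : P.Nonempty) (hE : IsFace P E) (hG : IsFace P G) (hEF : E ⊆ F) {u c p q : Fin n → ℤ}
    (hu : IsFacetNormal F G u c) (hp : lattice E = Submodule.span ℤ {p}) (hq : q ⬝ᵥ p = 1) :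
    latticeIndex (normalCone P E) (normalCone P G) = (u ⬝ᵥ p).natAbs := by
  have hpE : p ∈ lattice E := hp ▸ Submodule.mem_span_singleton_self p
  have hlE : ∀ z, z ∈ lattice (normalCone P E) ↔ z ⬝ᵥ p = 0 := by
    intro z
    rw [mem_lattice_normalCone hP hne hE]
    refine ⟨fun h => h p hpE, fun h w hw => ?_⟩
    rw [hp, Submodule.mem_span_singleton] at hw
    obtain ⟨m, rfl⟩ := hw
    rw [dotProduct_smul, h, smul_zero]
  have huG : u ∈ lattice (normalCone P G) := by
    rw [mem_lattice_normalCone hP hne hG]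
    intro w hw
    have := mem_perp.mp hu.mem_perp _ hw
    rwa [intVec_dotProduct_intVec, Int.cast_eq_zero] at this
  -- Pairing with `p` is onto `ℤ` because of `q`, and its kernel is the lattice of the cone of `E`.
  -- The index is therefore that of the image of the other lattice, which `u ⬝ᵥ p` generates:
  -- functionals vanishing on `lattice G` send `p` to a multiple of `u ⬝ᵥ p`.
  let f : (Fin n → ℤ) →+ ℤ := (dotProductEquiv ℤ (Fin n) p).toAddMonoidHom
  have hf : ∀ z, f z = z ⬝ᵥ p := fun z => dotProduct_comm p z
  have hsurj : Function.Surjective f := fun m => ⟨m • q, by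
    rw [hf, smul_dotProduct, hq, smul_eq_mul, mul_one]⟩
  have hcomap : (lattice (normalCone P E) ⊔ lattice (normalCone P G)).toAddSubgroup =
      (AddSubgroup.zmultiples (u ⬝ᵥ p)).comap f := by
    ext z
    rw [Submodule.mem_toAddSubgroup, AddSubgroup.mem_comap, AddSubgroup.mem_zmultiples_iff, hf]
    constructor
    · intro hz
      obtain ⟨y, hy, w, hw, rfl⟩ := Submodule.mem_sup.mp hz
      refine ⟨w ⬝ᵥ c, ?_⟩
      have h := (mem_lattice_normalCone hP hne hG).mp hw _
        (hu.sub_mem p (lattice_mono hEF hpE))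
      rw [dotProduct_sub, dotProduct_smul, smul_eq_mul] at h
      rw [add_dotProduct, (hlE y).mp hy, smul_eq_mul]
      linarith
    · rintro ⟨m, hm⟩
      refine Submodule.mem_sup.mpr ⟨z - m • u, ?_, m • u, Submodule.smul_mem _ m huG, by simp⟩
      rw [hlE, sub_dotProduct, smul_dotProduct, hm, sub_self]
  rw [latticeIndex, hcomap, AddSubgroup.index_comap_of_surjective _ hsurj, Int.index_zmultiples]

/-- An edge of a rational polytope. -/
theorem exists_edge {E : Set (Fin n → ℝ)} (hE : IsRationalPolytope E) (hne : E.Nonempty)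
    (hdim : dim E = 1) : ∃ (a : Fin n → ℝ) (p q : Fin n → ℤ) (l : ℝ), 0 < l ∧
      lattice E = Submodule.span ℤ {p} ∧ q ⬝ᵥ p = 1 ∧
      E = (fun t : ℝ => a + t • intVec n p) '' Icc 0 l ∧
      latticeLength E = l ∧ normalizedVolume E = l := by
  obtain ⟨b⟩ := hE.exists_basis hdim
  let p : Fin n → ℤ := b 0
  have hpE : p ∈ lattice E := (b 0).2
  have hlat : lattice E = Submodule.span ℤ {p} := by
    apply le_antisymm
    · intro z hz
      have := congrArg Subtype.val (b.sum_repr ⟨z, hz⟩)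
      rw [Fin.sum_univ_one] at this
      exact Submodule.mem_span_singleton.mpr ⟨_, this⟩
    · rw [Submodule.span_singleton_le_iff_mem]; exact hpE
  -- `q` is an integral coordinate along the edge; it selects the endpoints `a`, `a'` and certifies
  -- that `p` is primitive.
  obtain ⟨q, hq⟩ := exists_dotProduct_eq (b.coord 0)
  have hqp : q ⬝ᵥ p = 1 := by rw [hq]; simp
  have hqp' : intVec n q ⬝ᵥ intVec n p = 1 := by rw [intVec_dotProduct_intVec, hqp, Int.cast_one]
  have hspan : ∀ x ∈ vectorSpan ℝ E, x = (intVec n q ⬝ᵥ x) • intVec n p := by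
    intro x hx
    rw [← hE.range_latticeMap b] at hx
    obtain ⟨y, rfl⟩ := hx
    rw [latticeMap_apply, Fin.sum_univ_one, dotProduct_smul, hqp', smul_eq_mul, mul_one]
  obtain ⟨a, ha⟩ := hE.face_nonempty hne (-intVec n q)
  obtain ⟨a', ha'⟩ := hE.face_nonempty hne (intVec n q)
  let l := intVec n q ⬝ᵥ (a' - a)
  have hline : ∀ x ∈ E, x = a + (intVec n q ⬝ᵥ (x - a)) • intVec n p := by
    intro x hx
    rw [← hspan _ (sub_mem_vectorSpan hx ha.1), add_sub_cancel]
  have hEeq : E = (fun t : ℝ => a + t • intVec n p) '' Icc 0 l := by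
    apply Subset.antisymm
    · intro x hx
      refine ⟨_, ⟨?_, ?_⟩, (hline x hx).symm⟩
      · have := ha.2 x hx
        rw [neg_dotProduct, neg_dotProduct] at this
        rw [dotProduct_sub]; linarith
      · have := ha'.2 x hx
        simp only [l, dotProduct_sub]; linarith
    · rintro _ ⟨t, ⟨h0, h1⟩, rfl⟩
      rcases h0.eq_or_lt with rfl | h0
      · simpa using ha.1
      have hl : 0 < l := h0.trans_le h1
      have := hE.convex.add_smul_sub_mem ha.1 ha'.1 (t := t / l)
        ⟨by positivity, (div_le_one hl).mpr h1⟩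
      rwa [hspan _ (sub_mem_vectorSpan ha'.1 ha.1), smul_smul, div_mul_cancel₀ _ hl.ne'] at this
  have hlpos : 0 < l := by
    by_contra hcon
    have : E.Subsingleton := by
      rw [hEeq]
      rintro _ ⟨s, ⟨hs, hs'⟩, rfl⟩ _ ⟨t, ⟨ht, ht'⟩, rfl⟩
      rw [show s = t by linarith]
    rw [dim, (vectorSpan_eq_bot_iff_subsingleton ℝ).mpr this, finrank_bot] at hdim
    exact zero_ne_one hdim
  refine ⟨a, p, q, l, hlpos, hlat, hqp, hEeq, ?_, ?_⟩
  · have hprim : ∀ r : Fin n → ℤ, r ⬝ᵥ p = 1 → Finset.univ.gcd p = 1 := by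
      intro r hr
      have h1 : Finset.univ.gcd p ∣ 1 := by
        rw [← hr]
        exact Finset.dvd_sum fun i hi => (Finset.gcd_dvd hi).mul_left _
      rw [← Finset.normalize_gcd]
      exact normalize_eq_one.mpr (isUnit_of_dvd_one h1)
    refine IsGreatest.csSup_eq ⟨⟨a, ha.1, a', ha'.1, p, hprim q hqp,
      hspan _ (sub_mem_vectorSpan ha'.1 ha.1)⟩, ?_⟩
    -- A primitive vector parallel to the edge is `± p`, so `m` is bounded by the `q`-width `l`.
    rintro m ⟨x, hx, y, hy, p', hp', hm⟩
    by_contra hcon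
    have hm0 : 0 < m := hlpos.trans (not_le.mp hcon)
    have hp'E : p' ∈ lattice E := by
      rw [mem_lattice, ← Submodule.smul_mem_iff _ hm0.ne', ← hm]
      exact sub_mem_vectorSpan hy hx
    rw [hlat, Submodule.mem_span_singleton] at hp'E
    obtain ⟨k, rfl⟩ := hp'E
    have hk : |(k : ℝ)| = 1 := by
      have : (Finset.univ.gcd fun i => k * p i) = 1 := hp'
      rw [Finset.gcd_mul_left, hprim q hqp, mul_one] at this
      have h := Int.isUnit_iff.mp (normalize_eq_one.mp this)
      rcases h with h | h <;> simp [h]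
    have hyx : |intVec n q ⬝ᵥ (y - x)| ≤ l := by
      have h1 := ha.2 x hx
      have h2 := ha.2 y hy
      have h3 := ha'.2 x hx
      have h4 := ha'.2 y hy
      rw [neg_dotProduct, neg_dotProduct] at h1 h2
      rw [abs_le]
      simp only [l, dotProduct_sub]
      constructor <;> linarith
    rw [hm, map_smul, ← Int.cast_smul_eq_zsmul ℝ, dotProduct_smul, dotProduct_smul, hqp',
      smul_eq_mul, smul_eq_mul, mul_one, abs_mul, hk, mul_one, abs_of_pos hm0] at hyx
    exact hcon hyx
  · rw [hE.normalizedVolume_eq b ha.1 (p := a) (by simp), coordVolume]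
    have : {x : Fin 1 → ℝ | a + latticeMap (fun i => (b i : Fin n → ℤ)) x ∈ E} =
        Set.pi univ fun _ => Icc 0 l := by
      ext x
      rw [mem_ofPred_eq, latticeMap_apply, Fin.sum_univ_one, Set.ext_iff.mp hEeq _]
      simp only [mem_image, mem_univ_pi, Fin.forall_fin_one]
      constructor
      · rintro ⟨t, ht, h⟩
        have h := congrArg (intVec n q ⬝ᵥ ·) (add_left_cancel h)
        simp only [dotProduct_smul, smul_eq_mul] at h
        change t * (intVec n q ⬝ᵥ intVec n p) = x 0 * (intVec n q ⬝ᵥ intVec n p) at h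
        rw [hqp', mul_one, mul_one] at h
        rwa [← h]
      · intro h
        exact ⟨_, h, rfl⟩
    rw [this, volume_pi_pi]
    simp [hlpos.le]

/-! ### Coordinates on the affine span of a rational polytope -/

section Coordinates

variable {F : Set (Fin n → ℝ)} {k : ℕ} (b : Module.Basis (Fin k) ℤ (lattice F)) {w : Fin n → ℝ}

theorem IsRationalPolytope.exists_coord (hF : IsRationalPolytope F) (hw : w ∈ F) {x : Fin n → ℝ}
    (hx : x ∈ F) : ∃ y, x = w + latticeMap (fun i => (b i : Fin n → ℤ)) y := by
  have : x - w ∈ LinearMap.range (latticeMap fun i => (b i : Fin n → ℤ)) := by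
    rw [hF.range_latticeMap b]; exact sub_mem_vectorSpan hx hw
  obtain ⟨y, hy⟩ := this
  exact ⟨y, by rw [hy, add_sub_cancel]⟩

theorem isClosedEmbedding_coord (w : Fin n → ℝ) :
    IsClosedEmbedding fun y => w + latticeMap (fun i => (b i : Fin n → ℤ)) y :=
  (Homeomorph.addLeft w).isClosedEmbedding.comp
    (LinearMap.isClosedEmbedding_of_injective (LinearMap.ker_eq_bot.mpr (latticeMap_injective b)))

theorem convex_coord (hF : IsRationalPolytope F) (w : Fin n → ℝ) :
    Convex ℝ {y | w + latticeMap (fun i => (b i : Fin n → ℤ)) y ∈ F} := by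
  have h := (hF.convex.translate_preimage_right w).linear_preimage
    (latticeMap fun i => (b i : Fin n → ℤ))
  exact h

/-- In lattice coordinates the polytope is a convex set whose affine span is everything. -/
theorem interior_coord_nonempty (hF : IsRationalPolytope F) (hw : w ∈ F) :
    (interior {y | w + latticeMap (fun i => (b i : Fin n → ℤ)) y ∈ F}).Nonempty := by
  rw [(convex_coord b hF w).interior_nonempty_iff_affineSpan_eq_top,
    AffineSubspace.affineSpan_eq_top_iff_vectorSpan_eq_top_of_nonempty ℝ _ _
      ⟨0, by simpa using hw⟩, eq_top_iff]
  intro z _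
  have hle : vectorSpan ℝ F ≤ (vectorSpan ℝ
      {y | w + latticeMap (fun i => (b i : Fin n → ℤ)) y ∈ F}).map
      (latticeMap fun i => (b i : Fin n → ℤ)) := by
    rw [vectorSpan_le_iff]
    intro x hx y hy
    obtain ⟨x, rfl⟩ := hF.exists_coord b hw hx
    obtain ⟨y, rfl⟩ := hF.exists_coord b hw hy
    exact ⟨x - y, vsub_mem_vectorSpan ℝ hx hy, by simp⟩
  have hz : latticeMap (fun i => (b i : Fin n → ℤ)) z ∈ vectorSpan ℝ F := by
    rw [← hF.range_latticeMap b]; exact ⟨z, rfl⟩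
  obtain ⟨z', hz', h⟩ := hle hz
  rwa [← latticeMap_injective b h]

theorem coordVolume_pos (hF : IsRationalPolytope F) (hw : w ∈ F) :
    0 < coordVolume w (fun i => (b i : Fin n → ℤ)) F :=
  Measure.measure_pos_of_nonempty_interior _ (interior_coord_nonempty b hF hw)

theorem coordVolume_lt_top (hF : IsRationalPolytope F) (w : Fin n → ℝ) :
    coordVolume w (fun i => (b i : Fin n → ℤ)) F < ⊤ :=
  ((isClosedEmbedding_coord b w).isCompact_preimage hF.isCompact).measure_lt_top

/-- In coordinates `S` lies in the preimage of `W`, a proper subspace. -/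
theorem coordVolume_eq_zero (hF : IsRationalPolytope F) {S : Set (Fin n → ℝ)}
    {W : Submodule ℝ (Fin n → ℝ)} (hS : ∀ s ∈ S, s - w ∈ W) (hW : ¬ vectorSpan ℝ F ≤ W) :
    coordVolume w (fun i => (b i : Fin n → ℤ)) S = 0 := by
  have hsub : {y | w + latticeMap (fun i => (b i : Fin n → ℤ)) y ∈ S} ⊆
      (W.comap (latticeMap fun i => (b i : Fin n → ℤ)) : Submodule ℝ (Fin k → ℝ)) := by
    intro y hy
    have := hS _ hy
    rwa [add_sub_cancel_left] at this
  refine measure_mono_null hsub (Measure.addHaar_submodule _ _ fun htop => hW ?_)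
  rw [← hF.range_latticeMap b]
  rintro _ ⟨y, rfl⟩
  have : y ∈ W.comap (latticeMap fun i => (b i : Fin n → ℤ)) := htop ▸ Submodule.mem_top
  exact this

end Coordinates

theorem IsRationalPolytope.normalizedVolume_pos {P : Set (Fin n → ℝ)} (hP : IsRationalPolytope P)
    (hne : P.Nonempty) : 0 < normalizedVolume P := by
  obtain ⟨q, hq⟩ := hne
  have b := Module.finBasis ℤ (lattice P)
  rw [hP.normalizedVolume_eq b hq (p := q) (by simp)]
  have := ENNReal.toReal_pos (coordVolume_pos b hP hq).ne' (coordVolume_lt_top b hP q).ne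
  positivity

/-! ### Pyramids -/

/-- The union of the segments from `w` to the points of `G`. -/
def pyramid (w : Fin n → ℝ) (G : Set (Fin n → ℝ)) : Set (Fin n → ℝ) :=
  {x | ∃ t : ℝ, 0 ≤ t ∧ t ≤ 1 ∧ ∃ g ∈ G, x = w + t • (g - w)}

theorem pyramid_subset {F G : Set (Fin n → ℝ)} (hF : Convex ℝ F) {w : Fin n → ℝ} (hw : w ∈ F)
    (hG : G ⊆ F) : pyramid w G ⊆ F := by
  rintro x ⟨t, h0, h1, g, hg, rfl⟩
  exact hF.add_smul_sub_mem hw (hG hg) ⟨h0, h1⟩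

theorem isCompact_pyramid {G : Set (Fin n → ℝ)} (hG : IsCompact G) (w : Fin n → ℝ) :
    IsCompact (pyramid w G) := by
  have : pyramid w G = (fun p : ℝ × (Fin n → ℝ) => w + p.1 • (p.2 - w)) '' (Icc 0 1 ×ˢ G) := by
    ext x
    constructor
    · rintro ⟨t, h0, h1, g, hg, rfl⟩
      exact ⟨(t, g), ⟨⟨h0, h1⟩, hg⟩, rfl⟩
    · rintro ⟨⟨t, g⟩, ⟨⟨h0, h1⟩, hg⟩, rfl⟩
      exact ⟨t, h0, h1, g, hg, rfl⟩
  rw [this]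
  exact (isCompact_Icc.prod hG).image (by fun_prop)

/-- Every point of a polytope is on a segment from `w` to a point of a proper face. -/
theorem exists_mem_pyramid {F : Set (Fin n → ℝ)} (hF : IsRationalPolytope F) {w x : Fin n → ℝ}
    (hw : w ∈ F) (hx : x ∈ F) (hxw : x ≠ w) : ∃ H, IsFace F H ∧ H ≠ F ∧ x ∈ pyramid w H := by
  have b := Module.finBasis ℤ (lattice F)
  set L := latticeMap fun i => (b i : Fin n → ℤ) with hL
  have hemb : IsClosedEmbedding fun t : ℝ => w + t • (x - w) :=
    (Homeomorph.addLeft w).isClosedEmbedding.comp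
      (isClosedEmbedding_smul_left (sub_ne_zero.mpr hxw))
  -- `t` is the parameter at which the ray from `w` through `x` leaves `F`; a hyperplane supporting
  -- `F` at the exit point yields the face.
  obtain ⟨t, ht, hmax⟩ := (hemb.isCompact_preimage hF.isCompact).exists_isMaxOn
    ⟨1, by simpa using hx⟩ continuousOn_id
  have ht1 : 1 ≤ t := hmax (show (1 : ℝ) ∈ (fun t : ℝ => w + t • (x - w)) ⁻¹' F by simpa using hx)
  have htpos : 0 < t := by linarith
  have hy : w + t • (x - w) ∈ F := ht
  obtain ⟨ξ, hξ⟩ := hF.exists_coord b hw hx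
  have hLξ : L ξ = x - w := by rw [hξ, add_sub_cancel_left]
  set Q := {y | w + L y ∈ F} with hQ
  have hnot : t • ξ ∉ interior Q := by
    intro hmem
    have hc : Continuous fun ε : ℝ => (t + ε) • ξ := by fun_prop
    have hev : ∀ᶠ ε in 𝓝 (0 : ℝ), (t + ε) • ξ ∈ interior Q :=
      hc.continuousAt.preimage_mem_nhds (isOpen_interior.mem_nhds (by simpa using hmem))
    obtain ⟨ε, hε, hpos⟩ := ((hev.filter_mono nhdsWithin_le_nhds).and
      (self_mem_nhdsWithin : ∀ᶠ ε in 𝓝[>] (0 : ℝ), ε ∈ Ioi (0 : ℝ))).exists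
    have hpos : 0 < ε := hpos
    have h1 : w + L ((t + ε) • ξ) ∈ F := by
      have h := interior_subset hε
      exact h
    rw [map_smul, hLξ] at h1
    have h2 : t + ε ≤ t := hmax h1
    linarith
  have hconv := convex_coord b hF w
  have hint := interior_coord_nonempty b hF hw
  obtain ⟨f, hf⟩ := geometric_hahn_banach_open_point hconv.interior isOpen_interior hnot
  have hfle : ∀ a ∈ Q, f a ≤ f (t • ξ) := by
    have hcl : closure (interior Q) ⊆ {a | f a ≤ f (t • ξ)} :=
      closure_minimal (fun a ha => (hf a ha).le) (isClosed_le f.continuous continuous_const)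
    rw [hconv.closure_interior_eq_closure_of_nonempty_interior hint] at hcl
    exact fun a ha => hcl (subset_closure ha)
  -- The separating functional lives on coordinate space; a left inverse of `L` carries it to a
  -- vector of `ℝⁿ`.
  obtain ⟨g, hg⟩ := L.exists_leftInverse_of_injective
    (LinearMap.ker_eq_bot.mpr (latticeMap_injective b))
  let ω := (dotProductEquiv ℝ (Fin n)).symm (f.toLinearMap ∘ₗ g)
  have hω : ∀ y, ω ⬝ᵥ L y = f y := by
    intro y
    have h := LinearMap.congr_fun
      ((dotProductEquiv ℝ (Fin n)).apply_symm_apply (f.toLinearMap ∘ₗ g)) (L y)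
    have h2 : g (L y) = y := LinearMap.congr_fun hg y
    rw [LinearMap.comp_apply, h2] at h
    exact h
  have hyt : w + t • (x - w) = w + L (t • ξ) := by rw [map_smul, hLξ]
  have hmemface : w + t • (x - w) ∈ face F ω := by
    refine ⟨hy, fun z hz => ?_⟩
    obtain ⟨z, rfl⟩ := hF.exists_coord b hw hz
    rw [hyt, dotProduct_add, dotProduct_add, hω, hω]
    gcongr
    exact hfle z hz
  refine ⟨face F ω, ⟨ω, rfl⟩, fun heq => ?_, t⁻¹, by positivity, inv_le_one_of_one_le₀ ht1,
    _, hmemface, ?_⟩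
  · obtain ⟨a, ha⟩ := hint
    have haF : w + L a ∈ F := by
      have h := interior_subset ha
      exact h
    have := dotProduct_eq_of_mem_face (show w + L a ∈ face F ω by rw [heq]; exact haF) hmemface
    rw [hyt, dotProduct_add, dotProduct_add, hω, hω] at this
    exact (hf a ha).ne (add_left_cancel this)
  · rw [add_sub_cancel_left, smul_smul, inv_mul_cancel₀ htpos.ne', one_smul, add_sub_cancel]

/-- Relative to `w` the pyramid lies in the span of the directions of `H` and one more vector, which
is too small for `F`. -/
theorem coordVolume_pyramid_eq_zero {F H : Set (Fin n → ℝ)} (hF : IsRationalPolytope F) {k : ℕ}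
    (b : Module.Basis (Fin k) ℤ (lattice F)) (w : Fin n → ℝ) (hdim : dim H + 1 < dim F) :
    coordVolume w (fun i => (b i : Fin n → ℤ)) (pyramid w H) = 0 := by
  rcases H.eq_empty_or_nonempty with rfl | ⟨g₀, hg₀⟩
  · refine coordVolume_eq_zero b hF (W := ⊥) ?_ ?_
    · rintro _ ⟨t, _, _, g, hg, _⟩; exact hg.elim
    · intro h
      have := Submodule.finrank_mono h
      rw [finrank_bot] at this
      change dim F ≤ 0 at this
      omega
  · refine coordVolume_eq_zero b hF (W := Submodule.span ℝ {g₀ - w} ⊔ vectorSpan ℝ H) ?_ ?_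
    · rintro _ ⟨t, _, _, g, hg, rfl⟩
      rw [add_sub_cancel_left, ← sub_add_sub_cancel' g₀ w g]
      refine Submodule.smul_mem _ _ (add_mem ?_ ?_)
      · exact Submodule.mem_sup_left (Submodule.mem_span_singleton_self _)
      · exact Submodule.mem_sup_right (sub_mem_vectorSpan hg hg₀)
    · intro h
      have h1 := Submodule.finrank_mono h
      have h2 := Submodule.finrank_add_le_finrank_add_finrank
        (Submodule.span ℝ {g₀ - w}) (vectorSpan ℝ H)
      have h3 := finrank_span_le_card (R := ℝ) ({g₀ - w} : Set (Fin n → ℝ))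
      simp only [toFinset_singleton, Finset.card_singleton] at h3
      change dim F ≤ _ at h1
      change _ ≤ _ + dim H at h2
      omega

theorem IsFacetNormal.sub_smul_mem_vectorSpan {F G : Set (Fin n → ℝ)} {u c : Fin n → ℤ}
    (h : IsFacetNormal F G u c) (hF : IsRationalPolytope F) {x : Fin n → ℝ}
    (hx : x ∈ vectorSpan ℝ F) :
    x - (intVec n u ⬝ᵥ x) • intVec n c ∈ vectorSpan ℝ G := by
  let f : (Fin n → ℝ) →ₗ[ℝ] (Fin n → ℝ) :=
    LinearMap.id - (dotProductEquiv ℝ (Fin n) (intVec n u)).smulRight (intVec n c)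
  have hf : ∀ x, f x = x - (intVec n u ⬝ᵥ x) • intVec n c := fun x => by simp [f]
  have : vectorSpan ℝ F ≤ (vectorSpan ℝ G).comap f := by
    rw [← hF.span_lattice, Submodule.span_le]
    rintro _ ⟨z, hz, rfl⟩
    have := h.sub_mem z hz
    rw [StableVolume.mem_lattice, map_sub, map_smul, ← Int.cast_smul_eq_zsmul ℝ,
      ← intVec_dotProduct_intVec] at this
    rw [SetLike.mem_coe, Submodule.mem_comap, hf]
    exact this
  have := this hx
  rwa [Submodule.mem_comap, hf] at this

/-- The integral of the slice volumes of a pyramid of height `h` over a unit base. The factor `1 /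
(d + 1)` is what turns `(d + 1)!` into `d!` in the normalized volumes. -/
theorem lintegral_Ioc_div_pow {h : ℝ} (hh : 0 < h) (d : ℕ) :
    ∫⁻ s in Ioc 0 h, ENNReal.ofReal ((s / h) ^ d) = ENNReal.ofReal (h / (d + 1)) := by
  rw [← ofReal_integral_eq_lintegral_ofReal]
  · rw [← intervalIntegral.integral_of_le hh.le,
      intervalIntegral.integral_comp_div (fun x => x ^ d) hh.ne', zero_div, div_self hh.ne',
      integral_pow]
    simp
    ring_nf
  · exact (Continuous.integrableOn_Icc (by fun_prop)).mono_set Ioc_subset_Icc_self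
  · refine (ae_restrict_iff' measurableSet_Ioc).mpr (Eventually.of_forall fun s hs => ?_)
    have := hs.1
    change 0 ≤ (s / h) ^ d
    positivity

theorem continuous_latticeMap {k : ℕ} (b : Fin k → Fin n → ℤ) : Continuous (latticeMap b) :=
  LinearMap.continuous_of_finiteDimensional _

theorem IsFacetNormal.dotProduct_le {F G : Set (Fin n → ℝ)} {u c : Fin n → ℤ}
    (h : IsFacetNormal F G u c) {g w : Fin n → ℝ} (hg : g ∈ G) (hw : w ∈ F) :
    0 ≤ intVec n u ⬝ᵥ (g - w) := by
  rw [dotProduct_sub, sub_nonneg]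
  exact (h.mem_normalCone hg).2 w hw

/-- A basis of the lattice of a polytope adapted to one of its facets. -/
theorem IsFacetNormal.exists_adapted_basis {F G : Set (Fin n → ℝ)} {u c : Fin n → ℤ}
    (h : IsFacetNormal F G u c) {d : ℕ} (b : Module.Basis (Fin d) ℤ (lattice G)) :
    ∃ B : Module.Basis (Fin (d + 1)) ℤ (lattice F), ∀ x,
      latticeMap (fun i => (B i : Fin n → ℤ)) x =
        x 0 • intVec n c + latticeMap (fun i => (b i : Fin n → ℤ)) (fun i => x i.succ) := by
  have hle : lattice G ≤ lattice F := lattice_mono h.isFace.subset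
  refine ⟨Module.Basis.mkFinConsOfLE c h.mem_lattice b hle ?_ ?_, fun x => ?_⟩
  · intro m x hx hm
    have h1 := StableVolume.mem_perp.mp h.mem_perp _ hx
    rw [intVec_dotProduct_intVec, Int.cast_eq_zero] at h1
    have h2 := congrArg (u ⬝ᵥ ·) hm
    simpa only [dotProduct_add, dotProduct_smul, h1, h.dotProduct_eq_one, smul_eq_mul, mul_one,
      add_zero, dotProduct_zero] using h2
  · intro z hz
    refine ⟨-(u ⬝ᵥ z), ?_⟩
    rw [neg_smul, ← sub_eq_add_neg]
    exact h.sub_mem z hz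
  · rw [latticeMap_apply, Fin.sum_univ_succ, latticeMap_apply]
    simp

/-- Fubini in a basis whose first coordinate is the height `u`: the slice at height `s` is the base
scaled by `s / ht`, and at height zero the pyramid is flat. -/
theorem coordVolume_pyramid_facet {F G : Set (Fin n → ℝ)} {u c : Fin n → ℤ}
    (hF : IsRationalPolytope F) (h : IsFacetNormal F G u c) {d : ℕ}
    (b' : Module.Basis (Fin d) ℤ (lattice G)) (b : Module.Basis (Fin (d + 1)) ℤ (lattice F))
    {w g : Fin n → ℝ} (hw : w ∈ F) (hg : g ∈ G) :
    coordVolume w (fun i => (b i : Fin n → ℤ)) (pyramid w G) =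
      ENNReal.ofReal (intVec n u ⬝ᵥ (g - w) / (d + 1)) *
        coordVolume g (fun i => (b' i : Fin n → ℤ)) G := by
  have hG : IsRationalPolytope G := hF.of_isFace h.isFace
  have hht : ∀ g' ∈ G, intVec n u ⬝ᵥ (g' - w) = intVec n u ⬝ᵥ (g - w) := by
    intro g' hg'
    rw [dotProduct_sub, dotProduct_sub,
      dotProduct_eq_of_mem_face (h.mem_normalCone hg') (h.mem_normalCone hg)]
  set ht := intVec n u ⬝ᵥ (g - w) with hht_def
  rcases (h.dotProduct_le hg hw).eq_or_lt with h0 | hpos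
  · rw [← hht_def] at h0
    rw [← h0, zero_div, ENNReal.ofReal_zero, zero_mul]
    refine coordVolume_eq_zero b hF (W := LinearMap.ker (dotProductEquiv ℝ (Fin n) (intVec n u)))
      ?_ ?_
    · rintro _ ⟨t, _, _, g', hg', rfl⟩
      have := hht g' hg'
      rw [add_sub_cancel_left, LinearMap.mem_ker, map_smul]
      simp [this, ← h0]
    · intro hle
      have := hle h.mem_lattice
      rw [LinearMap.mem_ker] at this
      exact one_ne_zero (h.intVec_dotProduct.symm.trans this)
  rw [← hht_def] at hpos
  obtain ⟨B, hB⟩ := h.exists_adapted_basis b'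
  set L := latticeMap fun i => (b' i : Fin n → ℤ) with hL
  have hLu : ∀ y, intVec n u ⬝ᵥ L y = 0 := by
    intro y
    refine mem_perp.mp h.mem_perp _ ?_
    rw [← hG.range_latticeMap b']
    exact ⟨y, rfl⟩
  have hLcont : Continuous L := continuous_latticeMap _
  rw [coordVolume_eq B b (p := w) (by rw [sub_self]; exact zero_mem _)]
  -- The base point moves to `w + ht • c`, in the affine span of `G`, so that homothety from `w`
  -- becomes scaling of coordinates about the origin.
  have hbase : coordVolume g (fun i => (b' i : Fin n → ℤ)) G =
      volume {y | w + ht • intVec n c + L y ∈ G} := by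
    symm
    refine coordVolume_eq b' b' ?_ G
    rw [hG.span_lattice]
    have := neg_mem (h.sub_smul_mem_vectorSpan hF
      (sub_mem_vectorSpan (h.isFace.subset hg) hw))
    convert this using 1
    rw [← hht_def]
    abel
  rw [hbase]
  set Q := {y | w + ht • intVec n c + L y ∈ G} with hQ
  let T : Set (ℝ × (Fin d → ℝ)) := {p | w + (p.1 • intVec n c + L p.2) ∈ pyramid w G}
  have hTmeas : MeasurableSet T := by
    refine ((isCompact_pyramid hG.isCompact w).isClosed.preimage ?_).measurableSet
    fun_prop
  have hvol : coordVolume w (fun i => (B i : Fin n → ℤ)) (pyramid w G) = volume T := by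
    rw [← (volume_preserving_piFinSuccAbove (fun _ : Fin (d + 1) => ℝ) 0).measure_preimage_equiv]
    unfold coordVolume
    congr 1
    ext x
    simp only [mem_ofPred_eq, hB]
    rfl
  -- Height zero is excluded: there the slice is the origin, which has measure one when `d = 0`.
  have hsec : ∀ s : ℝ, s ≠ 0 → volume (Prod.mk s ⁻¹' T) =
      (Ioc 0 ht).indicator (fun s => ENNReal.ofReal ((s / ht) ^ d) * volume Q) s := by
    intro s hs
    have hmem : ∀ y, (s, y) ∈ T → ∃ g' ∈ G, s ∈ Ioc 0 ht ∧
        s • intVec n c + L y = (s / ht) • (g' - w) := by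
      rintro y ⟨t, h0, h1, g', hg', hy⟩
      have hy := add_left_cancel hy
      have hst : s = t * ht := by
        have := congrArg (intVec n u ⬝ᵥ ·) hy
        simpa only [dotProduct_add, dotProduct_smul, hLu, h.intVec_dotProduct, hht g' hg',
          smul_eq_mul, mul_one, add_zero] using this
      have htpos : 0 < t := lt_of_le_of_ne h0 fun h => hs (by rw [hst, ← h, zero_mul])
      refine ⟨g', hg', ⟨by rw [hst]; positivity, by rw [hst]; nlinarith⟩, ?_⟩
      rw [hst, mul_div_cancel_right₀ _ hpos.ne', ← hy, hst]
    by_cases hsI : s ∈ Ioc 0 ht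
    · rw [indicator_of_mem hsI]
      have hs0 := hsI.1
      have : Prod.mk s ⁻¹' T = (s / ht) • Q := by
        ext y
        rw [mem_smul_set_iff_inv_smul_mem₀ (by positivity)]
        constructor
        · intro hy
          obtain ⟨g', hg', -, heq⟩ := hmem y hy
          change w + ht • intVec n c + L ((s / ht)⁻¹ • y) ∈ G
          have : w + ht • intVec n c + L ((s / ht)⁻¹ • y) = g' := by
            have h2 : ht • intVec n c + L ((s / ht)⁻¹ • y) =
                (s / ht)⁻¹ • (s • intVec n c + L y) := by
              rw [map_smul, smul_add, smul_smul]
              congr 2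
              field_simp
            rw [add_assoc, h2, heq, smul_smul, inv_mul_cancel₀ (by positivity), one_smul,
              add_sub_cancel]
          rwa [this]
        · intro hy
          have hy : w + ht • intVec n c + L ((s / ht)⁻¹ • y) ∈ G := hy
          refine ⟨s / ht, by positivity, (div_le_one hpos).mpr hsI.2, _, hy, ?_⟩
          rw [add_assoc, add_sub_cancel_left, map_smul, smul_add, smul_smul, smul_smul,
            mul_inv_cancel₀ (by positivity), div_mul_cancel₀ _ hpos.ne', one_smul]
      rw [this, Measure.addHaar_smul, Module.finrank_fin_fun, abs_of_nonneg (by positivity)]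
    · rw [indicator_of_notMem hsI]
      have : Prod.mk s ⁻¹' T = ∅ := by
        ext y
        simp only [mem_preimage, mem_empty_iff_false, iff_false]
        intro hy
        obtain ⟨_, _, h, _⟩ := hmem y hy
        exact hsI h
      rw [this, measure_empty]
  rw [hvol, Measure.volume_eq_prod, Measure.prod_apply hTmeas]
  have hae : ∀ᵐ s : ℝ, s ≠ 0 := by
    rw [ae_iff]; simp
  rw [lintegral_congr_ae (hae.mono hsec), lintegral_indicator measurableSet_Ioc,
    lintegral_mul_const _ (by fun_prop), lintegral_Ioc_div_pow hpos]

/-- The pyramid decomposition: the normalized volume of a polytope is the sum over its facets of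
the normalized volume of the facet times the lattice distance to a given point. -/
theorem normalizedVolume_eq_sum {F : Set (Fin n → ℝ)} (hF : IsRationalPolytope F)
    {w : Fin n → ℝ} (hw : w ∈ F) {d : ℕ} (hdim : dim F = d + 1)
    {𝒢 : Finset (Set (Fin n → ℝ))} (h𝒢 : ∀ G, G ∈ 𝒢 ↔ IsFace F G ∧ dim G = d)
    {u c : Set (Fin n → ℝ) → Fin n → ℤ} (huc : ∀ G ∈ 𝒢, IsFacetNormal F G (u G) (c G))
    {g : Set (Fin n → ℝ) → Fin n → ℝ} (hg : ∀ G ∈ 𝒢, g G ∈ G) :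
    normalizedVolume F = ∑ G ∈ 𝒢, normalizedVolume G * (intVec n (u G) ⬝ᵥ (g G - w)) := by
  obtain ⟨b⟩ := hF.exists_basis hdim
  let A : (Fin (d + 1) → ℝ) → (Fin n → ℝ) := fun x => w + latticeMap (fun i => (b i : Fin n → ℤ)) x
  have hA : ∀ S, coordVolume w (fun i => (b i : Fin n → ℤ)) S = volume (A ⁻¹' S) := fun S => rfl
  have hne : F.Nonempty := ⟨w, hw⟩
  have hfin := hF.finite_faces
  have hGr : ∀ G ∈ 𝒢, IsRationalPolytope G := fun G hG => hF.of_isFace ((h𝒢 G).mp hG).1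
  have hnull : ∀ᵐ x, x ∉ A ⁻¹' {w} ∧ ∀ H ∈ {H | IsFace F H ∧ dim H + 1 < dim F},
      x ∉ A ⁻¹' pyramid w H := by
    refine Filter.Eventually.and ?_ ?_
    · rw [ae_iff]
      simp only [not_not]
      refine coordVolume_eq_zero b hF (S := {w}) (W := ⊥) (fun s hs => by simpa [sub_eq_zero] using hs) fun h => ?_
      have := Submodule.finrank_mono h
      rw [finrank_bot] at this
      change dim F ≤ 0 at this
      omega
    · rw [ae_ball_iff (hfin.subset fun H h => h.1).countable]
      intro H hH
      rw [ae_iff]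
      simp only [not_not]
      exact coordVolume_pyramid_eq_zero hF b w hH.2
  have hcover : (A ⁻¹' F : Set _) =ᵐ[volume] ⋃ G ∈ 𝒢, A ⁻¹' pyramid w G := by
    filter_upwards [hnull] with x hx
    refine propext ⟨fun hxF => ?_, fun hxU => ?_⟩
    · obtain ⟨H, hH, hne', hxH⟩ := exists_mem_pyramid hF hw hxF hx.1
      refine mem_iUnion₂.mpr ⟨H, (h𝒢 H).mpr ⟨hH, ?_⟩, hxH⟩
      have h1 := hH.dim_lt (hF.nonempty_of_isFace hne hH) hne'
      have h2 : ¬ (dim H + 1 < dim F) := fun hlt => hx.2 H ⟨hH, hlt⟩ hxH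
      omega
    · obtain ⟨G, hG, hxG⟩ := mem_iUnion₂.mp hxU
      exact pyramid_subset hF.convex hw ((h𝒢 G).mp hG).1.subset hxG
  have hvol : ∀ G ∈ 𝒢, ∀ b' : Module.Basis (Fin d) ℤ (lattice G), volume (A ⁻¹' pyramid w G) =
      ENNReal.ofReal (intVec n (u G) ⬝ᵥ (g G - w) / (d + 1)) *
        coordVolume (g G) (fun i => (b' i : Fin n → ℤ)) G :=
    fun G hG b' => coordVolume_pyramid_facet hF (huc G hG) b' b hw (hg G hG)
  have hdisj : (𝒢 : Set (Set (Fin n → ℝ))).Pairwise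
      (Function.onFun (AEDisjoint volume) fun G => A ⁻¹' pyramid w G) := by
    intro G hG G' hG' hGG'
    -- Facets at height zero over `w` have flat pyramids, so overlaps matter only for facets at
    -- positive height.
    have hzero : ∀ G ∈ 𝒢, intVec n (u G) ⬝ᵥ (g G - w) = 0 → volume (A ⁻¹' pyramid w G) = 0 := by
      intro G hG h0
      obtain ⟨b'⟩ := (hGr G hG).exists_basis ((h𝒢 G).mp hG).2
      rw [hvol G hG b', h0, zero_div, ENNReal.ofReal_zero, zero_mul]
    change volume (A ⁻¹' pyramid w G ∩ A ⁻¹' pyramid w G') = 0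
    by_cases h0 : intVec n (u G) ⬝ᵥ (g G - w) = 0
    · exact measure_mono_null inter_subset_left (hzero G hG h0)
    by_cases h0' : intVec n (u G') ⬝ᵥ (g G' - w) = 0
    · exact measure_mono_null inter_subset_right (hzero G' hG' h0')
    -- No point of `F` is higher than `G` in direction `u G`, so on a ray from `w` the facet `G` is
    -- met no earlier than any other point of `F`. Applied both ways, two pyramids overlap, apart
    -- from `w`, only over `G ∩ G'`.
    have hcomp : ∀ G ∈ 𝒢, ∀ x ∈ F, intVec n (u G) ⬝ᵥ (g G - w) ≠ 0 → ∀ t t' : ℝ, 0 < t' →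
        ∀ y ∈ G, t • (y - w) = t' • (x - w) → t ≤ t' := by
      intro G hG x hx hne0 t t' ht' y hy heq
      have hn := huc G hG
      have hle := hn.dotProduct_le hy hw
      have hy' := dotProduct_eq_of_mem_face (hn.mem_normalCone hy) (hn.mem_normalCone (hg G hG))
      have hxle := hn.dotProduct_le hy hx
      have heq := congrArg (intVec n (u G) ⬝ᵥ ·) heq
      simp only [dotProduct_smul, smul_eq_mul, dotProduct_sub] at heq hne0 hle hxle
      rw [← hy'] at hne0
      have hpos := lt_of_le_of_ne hle hne0.symm
      nlinarith
    have hsub : A ⁻¹' pyramid w G ∩ A ⁻¹' pyramid w G' ⊆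
        A ⁻¹' {w} ∪ A ⁻¹' pyramid w (G ∩ G') := by
      rintro x ⟨⟨t, ht0, ht1, y, hy, hxy⟩, ⟨t', ht0', ht1', y', hy', hxy'⟩⟩
      rcases ht0.eq_or_lt with rfl | ht0
      · left; simpa using hxy
      rcases ht0'.eq_or_lt with rfl | ht0'
      · left; simpa using hxy'
      right
      have heq : t • (y - w) = t' • (y' - w) := add_left_cancel (hxy.symm.trans hxy')
      have h1 := hcomp G hG y' (((h𝒢 G').mp hG').1.subset hy') h0 t t' ht0' y hy heq
      have h2 := hcomp G' hG' y (((h𝒢 G).mp hG).1.subset hy) h0' t' t ht0 y' hy' heq.symm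
      obtain rfl := le_antisymm h1 h2
      have hyy := sub_left_injective (smul_right_injective _ ht0.ne' heq)
      exact ⟨t, ht0.le, ht1, y, ⟨hy, hyy ▸ hy'⟩, hxy⟩
    have hmem := (h𝒢 G).mp hG
    have hmem' := (h𝒢 G').mp hG'
    have hpyr : volume (A ⁻¹' pyramid w (G ∩ G')) = 0 := by
      rcases (G ∩ G').eq_empty_or_nonempty with hemp | hne'
      · simp [hemp, pyramid]
      · refine coordVolume_pyramid_eq_zero hF b w ?_
        have hf := hmem.1.inter hmem'.1 hne'
        have hneq : G ∩ G' ≠ G := by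
          intro h
          have h1 : G ⊆ G' := inter_eq_left.mp h
          have h2 := (hmem.1.of_subset (hF.nonempty_of_isFace hne hmem.1)
            hmem'.1.subset h1).dim_lt (hF.nonempty_of_isFace hne hmem.1) hGG'
          omega
        have := (hf.of_subset hne' hmem.1.subset inter_subset_left).dim_lt hne' hneq
        omega
    refine measure_mono_null hsub (measure_union_null ?_ hpyr)
    refine measure_mono_null ?_ (ae_iff.mp (hnull.mono fun x hx => hx.1))
    intro x hx
    simpa using hx
  have hmeas : ∀ G ∈ 𝒢, NullMeasurableSet (A ⁻¹' pyramid w G) := by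
    intro G hG
    exact ((isCompact_pyramid (hGr G hG).isCompact w).isClosed.preimage
      (isClosedEmbedding_coord b w).continuous).measurableSet.nullMeasurableSet
  rw [hF.normalizedVolume_eq b hw (p := w) (by simp), hA, measure_congr hcover,
    measure_biUnion_finset₀ hdisj hmeas, ENNReal.toReal_sum, Finset.mul_sum]
  · refine Finset.sum_congr rfl fun G hG => ?_
    obtain ⟨b'⟩ := (hGr G hG).exists_basis ((h𝒢 G).mp hG).2
    have hnn := (huc G hG).dotProduct_le (hg G hG) hw
    rw [hvol G hG b', (hGr G hG).normalizedVolume_eq b' (hg G hG) (p := g G) (by simp),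
      ENNReal.toReal_mul, ENNReal.toReal_ofReal (by positivity), Nat.factorial_succ]
    push_cast
    field_simp
  · intro G hG
    obtain ⟨b'⟩ := (hGr G hG).exists_basis ((h𝒢 G).mp hG).2
    rw [hvol G hG b']
    exact ENNReal.mul_ne_top ENNReal.ofReal_ne_top (coordVolume_lt_top b' (hGr G hG) _).ne

/-! ### Existence of faces -/

/-- The volume of `F` is positive, so some term of the pyramid decomposition is positive: some facet
misses `w`. -/
theorem exists_isFacetNormal_pos {F : Set (Fin n → ℝ)} (hF : IsRationalPolytope F)
    {w : Fin n → ℝ} (hw : w ∈ F) {d : ℕ} (hdim : dim F = d + 1) :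
    ∃ G u c, dim G = d ∧ IsFacetNormal F G u c ∧ ∃ g ∈ G, 0 < intVec n u ⬝ᵥ (g - w) := by
  classical
  have hfin : {G | IsFace F G ∧ dim G = d}.Finite := hF.finite_faces.subset fun G h => h.1
  have hmem : ∀ G, G ∈ hfin.toFinset ↔ IsFace F G ∧ dim G = d := fun G => by simp
  have hex : ∀ G, ∃ (u c : Fin n → ℤ) (g : Fin n → ℝ), G ∈ hfin.toFinset →
      IsFacetNormal F G u c ∧ g ∈ G := by
    intro G
    by_cases hG : G ∈ hfin.toFinset
    · obtain ⟨h1, h2⟩ := (hmem G).mp hG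
      obtain ⟨u, c, huc⟩ := exists_isFacetNormal hF ⟨w, hw⟩ h1 (by omega)
      obtain ⟨g, hg⟩ := hF.nonempty_of_isFace ⟨w, hw⟩ h1
      exact ⟨u, c, g, fun _ => ⟨huc, hg⟩⟩
    · exact ⟨0, 0, 0, fun h => absurd h hG⟩
  choose u c g h using hex
  have hvol := normalizedVolume_eq_sum hF hw hdim hmem (fun G hG => (h G hG).1)
    (fun G hG => (h G hG).2)
  have hpos := hF.normalizedVolume_pos ⟨w, hw⟩
  rw [hvol] at hpos
  rw [← Finset.sum_const_zero (s := hfin.toFinset)] at hpos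
  obtain ⟨G, hG, hGpos⟩ := Finset.exists_lt_of_sum_lt hpos
  refine ⟨G, u G, c G, ((hmem G).mp hG).2, (h G hG).1, g G, (h G hG).2, ?_⟩
  have hnn := (h G hG).1.dotProduct_le (h G hG).2 hw
  refine lt_of_le_of_ne hnn fun h0 => ?_
  rw [← h0, mul_zero] at hGpos
  exact hGpos.false

theorem exists_isFace_dim_eq (k : ℕ) {F : Set (Fin n → ℝ)} (hF : IsRationalPolytope F)
    (hne : F.Nonempty) (hk : k ≤ dim F) : ∃ G, IsFace F G ∧ dim G = k := by
  obtain ⟨m, hm⟩ := Nat.exists_eq_add_of_le hk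
  induction m generalizing F with
  | zero => exact ⟨F, isFace_self F, hm⟩
  | succ m ih =>
    obtain ⟨w, hw⟩ := hne
    obtain ⟨G, u, c, hG, huc, -⟩ := exists_isFacetNormal_pos hF hw (d := k + m) (by omega)
    obtain ⟨K, hK, hKdim⟩ := ih (hF.of_isFace huc.isFace)
      (hF.nonempty_of_isFace ⟨w, hw⟩ huc.isFace) (by omega) hG
    exact ⟨K, hF.isFace_trans ⟨w, hw⟩ huc.isFace hK, hKdim⟩

/-! ### Crossing edges along a ray of functionals -/

/-- Maximizers climb in the direction in which the functional is pushed. -/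
theorem le_of_mem_face_add_smul {F : Set (Fin n → ℝ)} {u v w x : Fin n → ℝ} {t : ℝ} (ht : 0 < t)
    (hw : w ∈ face F v) (hx : x ∈ face F (v + t • u)) : u ⬝ᵥ w ≤ u ⬝ᵥ x := by
  have h1 := hx.2 w hw.1
  have h2 := hw.2 x hx.1
  simp only [add_dotProduct, smul_dotProduct, smul_eq_mul] at h1
  by_contra hcon
  nlinarith

/-- The parameters whose face has a point of `u`-height at most `s`, and those with height at least
`s`, form closed sets covering `[0, T]`. By connectedness they meet, and a face at a common
parameter is convex, so it attains `s`. -/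
theorem exists_mem_face_add_smul {F : Set (Fin n → ℝ)} (hF : IsRationalPolytope F)
    {u v w y : Fin n → ℝ} {s : ℝ} (hw : w ∈ face F v) (hws : u ⬝ᵥ w ≤ s) (hy : y ∈ F)
    (hys : s < u ⬝ᵥ y) : ∃ t : ℝ, 0 ≤ t ∧ ∃ x ∈ face F (v + t • u), u ⬝ᵥ x = s := by
  have hne : F.Nonempty := ⟨y, hy⟩
  -- For this `T` the gain of `y` in `T • u` over any point below height `s` exceeds its deficit
  -- under `v`; the `+ 1` makes this strict.
  let T := (v ⬝ᵥ w - v ⬝ᵥ y) / (u ⬝ᵥ y - s) + 1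
  have hT : 0 ≤ T := add_nonneg (div_nonneg (sub_nonneg.mpr (hw.2 y hy)) (by linarith)) zero_le_one
  have hgraph : IsCompact {q : ℝ × (Fin n → ℝ) | q.1 ∈ Icc 0 T ∧ q.2 ∈ face F (v + q.1 • u)} := by
    have : {q : ℝ × (Fin n → ℝ) | q.1 ∈ Icc 0 T ∧ q.2 ∈ face F (v + q.1 • u)} =
        (Icc 0 T ×ˢ F) ∩ ⋂ z ∈ F, {q | (v + q.1 • u) ⬝ᵥ z ≤ (v + q.1 • u) ⬝ᵥ q.2} := by
      ext q
      simp only [face, mem_ofPred_eq, mem_inter_iff, mem_prod, mem_iInter]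
      tauto
    rw [this]
    refine (isCompact_Icc.prod hF.isCompact).inter_right
      (isClosed_biInter fun z _ => isClosed_le ?_ ?_)
    · fun_prop
    · fun_prop
  have hclosed : ∀ K : Set ℝ, IsClosed K →
      IsClosed {t | t ∈ Icc 0 T ∧ ∃ x ∈ face F (v + t • u), u ⬝ᵥ x ∈ K} := by
    intro K hK
    have hc : IsCompact ({q : ℝ × (Fin n → ℝ) | q.1 ∈ Icc 0 T ∧ q.2 ∈ face F (v + q.1 • u)} ∩
        {q | u ⬝ᵥ q.2 ∈ K}) := hgraph.inter_right (hK.preimage (by fun_prop))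
    convert (hc.image continuous_fst).isClosed using 1
    ext t
    constructor
    · rintro ⟨ht, x, hx, hxK⟩
      exact ⟨(t, x), ⟨⟨ht, hx⟩, hxK⟩, rfl⟩
    · rintro ⟨⟨t, x⟩, ⟨⟨ht, hx⟩, hxK⟩, rfl⟩
      exact ⟨ht, x, hx, hxK⟩
  obtain ⟨t, ht, ⟨-, x, hx, hxs⟩, -, x', hx', hxs'⟩ :=
    isPreconnected_closed_iff.mp (isPreconnected_Icc (a := 0) (b := T)) _ _
      (hclosed (Iic s) isClosed_Iic) (hclosed (Ici s) isClosed_Ici)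
      (by
        intro t ht
        obtain ⟨x, hx⟩ := hF.face_nonempty hne (v + t • u)
        rcases le_total (u ⬝ᵥ x) s with h | h
        · exact Or.inl ⟨ht, x, hx, h⟩
        · exact Or.inr ⟨ht, x, hx, h⟩)
      ⟨0, ⟨le_rfl, hT⟩, ⟨le_rfl, hT⟩, w, by simpa using hw, hws⟩
      (by
        obtain ⟨x, hx⟩ := hF.face_nonempty hne (v + T • u)
        refine ⟨T, ⟨hT, le_rfl⟩, ⟨hT, le_rfl⟩, x, hx, ?_⟩
        have h1 := hx.2 y hy
        have h2 := hw.2 x hx.1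
        have h3 := hw.2 y hy
        simp only [add_dotProduct, smul_dotProduct, smul_eq_mul] at h1
        have hTe : T * (u ⬝ᵥ y - s) = v ⬝ᵥ w - v ⬝ᵥ y + (u ⬝ᵥ y - s) := by
          rw [add_mul, div_mul_cancel₀ _ (by linarith), one_mul]
        change s ≤ u ⬝ᵥ x
        by_contra hcon
        nlinarith)
  obtain ⟨z, hz, hzs⟩ := (convex_face hF.convex (v + t • u)).isPreconnected.intermediate_value
    hx hx' (f := fun x => u ⬝ᵥ x) (Continuous.continuousOn (by fun_prop)) ⟨hxs, hxs'⟩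
  exact ⟨t, ht.1, z, hz, hzs⟩

/-- Pairing with `u` embeds the span into `ℝ`. This is how genericity makes every crossed face an
edge or a vertex. -/
theorem dim_le_one_of_injective {H : Set (Fin n → ℝ)} {u : Fin n → ℝ}
    (h : ∀ z ∈ vectorSpan ℝ H, u ⬝ᵥ z = 0 → z = 0) : dim H ≤ 1 := by
  have hinj : Function.Injective ((dotProductEquiv ℝ (Fin n) u).domRestrict (vectorSpan ℝ H)) := by
    rw [injective_iff_map_eq_zero]
    intro z hz
    exact Subtype.ext (h z z.2 hz)
  exact (LinearMap.finrank_le_finrank_of_injective hinj).trans (Module.finrank_self ℝ).le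

theorem volume_image_edge (u a p : Fin n → ℝ) {l : ℝ} (hl : 0 < l) :
    volume ((fun x => u ⬝ᵥ x) '' ((fun t : ℝ => a + t • p) '' Icc 0 l)) =
      ENNReal.ofReal (l * |u ⬝ᵥ p|) ∧
    MeasurableSet ((fun x => u ⬝ᵥ x) '' ((fun t : ℝ => a + t • p) '' Icc 0 l)) := by
  have : (fun x => u ⬝ᵥ x) '' ((fun t : ℝ => a + t • p) '' Icc 0 l) =
      uIcc (u ⬝ᵥ a) (u ⬝ᵥ a + l * (u ⬝ᵥ p)) := by
    rw [image_image, ← uIcc_of_le hl.le]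
    have h := image_image (fun x => u ⬝ᵥ a + x) (fun t => t * (u ⬝ᵥ p)) (uIcc 0 l)
    rw [image_mul_const_uIcc, image_const_add_uIcc, zero_mul, add_zero] at h
    rw [h]
    simp [dotProduct_add, dotProduct_smul]
  rw [this]
  refine ⟨?_, measurableSet_uIcc⟩
  rw [uIcc, Real.volume_Icc, max_sub_min_eq_abs, add_sub_cancel_left, abs_mul, abs_of_pos hl]

/-- Along a generic ray of functionals, the extents of the crossed edges add up to the extent of
the polytope above the starting vertex. -/
theorem sum_extent_crossed_edges {F : Set (Fin n → ℝ)} (hF : IsRationalPolytope F)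
    {u v w y : Fin n → ℝ} (hw : face F v = {w}) (hy : y ∈ face F u)
    (hgen : ∀ t : ℝ, 0 ≤ t → ∀ z ∈ vectorSpan ℝ (face F (v + t • u)), u ⬝ᵥ z = 0 → z = 0)
    {ℰ : Finset (Set (Fin n → ℝ))} (hℰ : ∀ E, E ∈ ℰ ↔ (IsFace F E ∧ dim E = 1) ∧
      ∃ t : ℝ, 0 ≤ t ∧ v + t • u ∈ normalCone F E)
    {a p : Set (Fin n → ℝ) → Fin n → ℝ} {l : Set (Fin n → ℝ) → ℝ}
    (hE : ∀ E ∈ ℰ, 0 < l E ∧ E = (fun t : ℝ => a E + t • p E) '' Icc 0 (l E)) :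
    ∑ E ∈ ℰ, l E * |u ⬝ᵥ p E| = u ⬝ᵥ (y - w) := by
  have hne : F.Nonempty := ⟨y, hy.1⟩
  have hwF : w ∈ face F v := by rw [hw]; rfl
  have hvol : ∀ E ∈ ℰ, volume ((fun x => u ⬝ᵥ x) '' E) = ENNReal.ofReal (l E * |u ⬝ᵥ p E|) ∧
      MeasurableSet ((fun x => u ⬝ᵥ x) '' E) := by
    intro E h
    have h2 := volume_image_edge u (a E) (p E) (hE E h).1
    rwa [← (hE E h).2] at h2
  have hsub_null : ∀ S : Set (Fin n → ℝ), S.Subsingleton →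
      volume ((fun x => u ⬝ᵥ x) '' S) = 0 := fun S hS =>
    (hS.image _).countable.measure_zero _
  have hnull : ∀ᵐ s : ℝ, s ≠ u ⬝ᵥ y ∧ ∀ H ∈ {H | IsFace F H ∧ dim H = 0},
      s ∉ (fun x => u ⬝ᵥ x) '' H := by
    refine Filter.Eventually.and (by rw [ae_iff]; simp) ?_
    rw [ae_ball_iff (hF.finite_faces.subset fun H h => h.1).countable]
    intro H hH
    rw [ae_iff]
    simp only [not_not]
    exact hsub_null H (subsingleton_of_dim_eq_zero hH.2)
  -- Apart from the top level and the finitely many vertex heights, each level is attained on a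
  -- crossed face that is not a vertex.
  have hcover : (Icc (u ⬝ᵥ w) (u ⬝ᵥ y) : Set ℝ) =ᵐ[volume] ⋃ E ∈ ℰ, (fun x => u ⬝ᵥ x) '' E := by
    filter_upwards [hnull] with s hs
    refine propext ⟨fun hsI => ?_, fun hsU => ?_⟩
    · obtain ⟨t, ht, x, hx, hxs⟩ := exists_mem_face_add_smul hF hwF hsI.1 hy.1
        (lt_of_le_of_ne hsI.2 hs.1)
      have h1 := dim_le_one_of_injective (hgen t ht)
      have h0 : dim (face F (v + t • u)) ≠ 0 := fun h0 =>
        hs.2 _ ⟨isFace_face F _, h0⟩ ⟨x, hx, hxs⟩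
      refine mem_iUnion₂.mpr ⟨face F (v + t • u), (hℰ _).mpr ⟨⟨isFace_face F _, by omega⟩, t, ht, ?_⟩,
        x, hx, hxs⟩
      exact fun _ h => h
    · obtain ⟨E, hEm, x, hx, rfl⟩ := mem_iUnion₂.mp hsU
      obtain ⟨-, t, ht, hcone⟩ := (hℰ E).mp hEm
      refine ⟨?_, hy.2 x (hcone hx).1⟩
      rcases ht.eq_or_lt with rfl | ht
      · have := hcone hx
        rw [zero_smul, add_zero, hw] at this
        rw [mem_singleton_iff.mp this]
      · exact le_of_mem_face_add_smul ht hwF (hcone hx)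
  have hdisj : (ℰ : Set (Set (Fin n → ℝ))).Pairwise
      (Function.onFun (AEDisjoint volume) fun E => (fun x => u ⬝ᵥ x) '' E) := by
    intro E hEm E' hEm' hneq
    obtain ⟨⟨hEf, hEd⟩, t, ht, hcone⟩ := (hℰ E).mp hEm
    obtain ⟨⟨hEf', hEd'⟩, t', ht', hcone'⟩ := (hℰ E').mp hEm'
    refine measure_mono_null (t := (fun x => u ⬝ᵥ x) '' (E ∩ E')) ?_ (hsub_null _ ?_)
    -- Points of equal `u`-height on two crossed edges also have equal `v`-value, so both lie in the
    -- face at `t`; genericity makes them equal.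
    · rintro s ⟨⟨x, hx, rfl⟩, ⟨x', hx', hxx'⟩⟩
      have hxx' : u ⬝ᵥ x' = u ⬝ᵥ x := hxx'
      have h1 := (hcone hx).2 x' (hcone' hx').1
      have h2 := (hcone' hx').2 x (hcone hx).1
      simp only [add_dotProduct, smul_dotProduct, smul_eq_mul, hxx'] at h1 h2
      have hmem : x' ∈ face F (v + t • u) := by
        refine mem_face_of_le (hcone hx) (hcone' hx').1 ?_
        simp only [add_dotProduct, smul_dotProduct, smul_eq_mul, hxx']
        linarith
      have := hgen t ht _ (sub_mem_vectorSpan (hcone hx) hmem) (by rw [dotProduct_sub, hxx', sub_self])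
      rw [sub_eq_zero] at this
      exact ⟨x, ⟨hx, this ▸ hx'⟩, rfl⟩
    · rcases (E ∩ E').eq_empty_or_nonempty with hemp | hne'
      · rw [hemp]; exact subsingleton_empty
      · have hf := hEf.inter hEf' hne'
        have hneqE : E ∩ E' ≠ E := by
          intro h
          have := (hEf.of_subset (hF.nonempty_of_isFace hne hEf) hEf'.subset
            (inter_eq_left.mp h)).dim_lt (hF.nonempty_of_isFace hne hEf) hneq
          omega
        have := (hf.of_subset hne' hEf.subset inter_subset_left).dim_lt hne' hneqE
        exact subsingleton_of_dim_eq_zero (by omega)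
  have hsum := measure_biUnion_finset₀ hdisj fun E h => (hvol E h).2.nullMeasurableSet
  rw [← measure_congr hcover, Real.volume_Icc, Finset.sum_congr rfl fun E h => (hvol E h).1,
    ← ENNReal.ofReal_sum_of_nonneg fun E h => mul_nonneg (hE E h).1.le (abs_nonneg _)] at hsum
  rw [dotProduct_sub]
  exact ((ENNReal.ofReal_eq_ofReal_iff (sub_nonneg.mpr (hy.2 w hwF.1))
    (Finset.sum_nonneg fun E h => mul_nonneg (hE E h).1.le (abs_nonneg _))).mp hsum).symm

/-! ### Generic functionals -/

theorem eq_zero_of_eq_top {S : Submodule ℝ (Fin n → ℝ)} (hS : S = ⊤) {x : Fin n → ℝ}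
    (h : ∀ y ∈ S, y ⬝ᵥ x = 0) : x = 0 :=
  dotProduct_self_eq_zero.mp (h x (hS ▸ Submodule.mem_top))

/-- `v` must avoid those subspaces `perp (vectorSpan ℝ H)` and their sums with `ℝ u` that are
proper. If `v + t • u` cuts out `H`, then `v` lies in such a sum, which is then all of `ℝⁿ`; a
vector parallel to `H` and killed by `u` is orthogonal to it, hence zero. -/
theorem exists_generic {F : Set (Fin n → ℝ)} (hF : IsRationalPolytope F)
    {𝒰 : Set (Fin n → ℝ)} (h𝒰 : 𝒰.Finite) :
    ∃ U : Set (Fin n → ℝ), IsOpen U ∧ Dense U ∧ ∀ v ∈ U, dim (face F v) = 0 ∧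
      ∀ u ∈ 𝒰, ∀ t : ℝ, ∀ z ∈ vectorSpan ℝ (face F (v + t • u)), u ⬝ᵥ z = 0 → z = 0 := by
  let S₁ : Set (Submodule ℝ (Fin n → ℝ)) := (fun H => perp (vectorSpan ℝ H)) '' {H | IsFace F H}
  let S₂ : Set (Submodule ℝ (Fin n → ℝ)) :=
    image2 (fun H u => perp (vectorSpan ℝ H) ⊔ Submodule.span ℝ {u}) {H | IsFace F H} 𝒰
  let S : Set (Submodule ℝ (Fin n → ℝ)) := {W | W ∈ S₁ ∪ S₂ ∧ W ≠ ⊤}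
  have hS : S.Finite :=
    ((hF.finite_faces.image _).union (hF.finite_faces.image2 _ h𝒰)).subset fun W h => h.1
  have hface : ∀ v, v ∈ perp (vectorSpan ℝ (face F v)) := fun v =>
    normalCone_subset_perp F (face F v) fun _ h => h
  refine ⟨{v | ∀ W ∈ S, v ∉ W}, ?_, ?_, fun v hv => ⟨?_, fun u hu t z hz huz => ?_⟩⟩
  · have : {v : Fin n → ℝ | ∀ W ∈ S, v ∉ W} = ⋂ W ∈ S, (W : Set (Fin n → ℝ))ᶜ := by
      ext v; simp
    rw [this]
    exact hS.isOpen_biInter fun W _ => W.closed_of_finiteDimensional.isOpen_compl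
  · refine Measure.dense_of_ae (μ := volume) ?_
    rw [ae_ball_iff hS.countable]
    intro W hW
    rw [ae_iff]
    simp only [not_not]
    exact Measure.addHaar_submodule _ W hW.2
  · have htop : perp (vectorSpan ℝ (face F v)) = ⊤ := by
      by_contra hne
      exact hv _ ⟨Or.inl ⟨_, isFace_face F v, rfl⟩, hne⟩ (hface v)
    rw [dim, Submodule.finrank_eq_zero, eq_bot_iff]
    intro x hx
    exact eq_zero_of_eq_top htop fun y hy => mem_perp.mp hy x hx
  · have htop : perp (vectorSpan ℝ (face F (v + t • u))) ⊔ Submodule.span ℝ {u} = ⊤ := by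
      by_contra hne
      refine hv _ ⟨Or.inr ⟨_, isFace_face F (v + t • u), u, hu, rfl⟩, hne⟩ ?_
      have h1 := Submodule.mem_sup_left (T := Submodule.span ℝ {u}) (hface (v + t • u))
      have h2 := Submodule.smul_mem _ t (Submodule.mem_sup_right
        (S := perp (vectorSpan ℝ (face F (v + t • u)))) (Submodule.mem_span_singleton_self (R := ℝ) u))
      simpa using sub_mem h1 h2
    refine eq_zero_of_eq_top htop fun y hy => ?_
    obtain ⟨y₁, hy₁, y₂, hy₂, rfl⟩ := Submodule.mem_sup.mp hy
    obtain ⟨m, rfl⟩ := Submodule.mem_span_singleton.mp hy₂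
    rw [add_dotProduct, smul_dotProduct, huz, mem_perp.mp hy₁ z hz, smul_zero, add_zero]

/-- The normal cones of edges minus the normal cones of `r`-dimensional faces cover the space. -/
theorem exists_sub_mem_normalCone {F : Set (Fin n → ℝ)} (hF : IsRationalPolytope F)
    (hne : F.Nonempty) {r : ℕ} (hr : r + 1 ≤ dim F) (v : Fin n → ℝ) :
    ∃ E G, IsFace F E ∧ dim E = 1 ∧ IsFace F G ∧ dim G = r ∧
      ∃ x ∈ normalCone F E, ∃ y ∈ normalCone F G, v = x - y := by
  by_cases hv : 1 ≤ dim (face F v)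
  · obtain ⟨E, hE, hEd⟩ := exists_isFace_dim_eq 1 (hF.face v) (hF.face_nonempty hne v) hv
    obtain ⟨G, hG, hGd⟩ := exists_isFace_dim_eq r hF hne (by omega)
    exact ⟨E, G, hF.isFace_trans hne (isFace_face F v) hE, hEd, hG, hGd, v, hE.subset, 0,
      zero_mem_normalCone hG.subset, by simp⟩
  · obtain ⟨w, hw⟩ := hF.face_nonempty hne v
    obtain ⟨d, hd⟩ : ∃ d, dim F = d + 1 := ⟨dim F - 1, by omega⟩
    obtain ⟨G', u, c, hG'd, huc, g, hg, hpos⟩ := exists_isFacetNormal_pos hF hw.1 hd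
    rw [dotProduct_sub, sub_pos] at hpos
    have hfin : (⋃ H ∈ {H | IsFace F H ∧ dim H = 0}, (fun x => intVec n u ⬝ᵥ x) '' H).Finite :=
      (hF.finite_faces.subset fun H h => h.1).biUnion fun H hH =>
        ((subsingleton_of_dim_eq_zero hH.2).image _).finite
    -- A level avoiding all vertex heights forces the face crossed there to have positive dimension,
    -- so it contains an edge. No genericity of `v` is needed.
    obtain ⟨s, hs, hsH⟩ := ((Ioo_infinite hpos).sdiff hfin).nonempty
    obtain ⟨t, ht, x, hx, hxs⟩ := exists_mem_face_add_smul hF hw hs.1.le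
      (huc.isFace.subset hg) hs.2
    have hdim : 1 ≤ dim (face F (v + t • intVec n u)) := by
      by_contra hcon
      exact hsH (mem_iUnion₂.mpr ⟨_, ⟨isFace_face F _, by omega⟩, x, hx, hxs⟩)
    obtain ⟨E, hE, hEd⟩ := exists_isFace_dim_eq 1 (hF.face _) (hF.face_nonempty hne _) hdim
    obtain ⟨G, hG, hGd⟩ := exists_isFace_dim_eq r (hF.of_isFace huc.isFace) ⟨g, hg⟩ (by omega)
    refine ⟨E, G, hF.isFace_trans hne (isFace_face F _) hE, hEd,
      hF.isFace_trans hne huc.isFace hG, hGd, _, hE.subset, _,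
      smul_mem_normalCone ht (normalCone_anti hG.subset huc.mem_normalCone), ?_⟩
    rw [add_sub_cancel_right]

/-! ### Stable powers of tropical hypersurfaces -/

theorem vectorSpan_univ : vectorSpan ℝ (univ : Set (Fin n → ℝ)) = ⊤ :=
  eq_top_iff.mpr fun x _ => by simpa using sub_mem_vectorSpan (mem_univ x) (mem_univ 0)

theorem dim_univ : dim (univ : Set (Fin n → ℝ)) = n := by
  rw [dim, vectorSpan_univ, finrank_top, Module.finrank_fin_fun]

theorem zero_mem_intrinsicInterior_submodule (W : Submodule ℝ (Fin n → ℝ)) :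
    (0 : Fin n → ℝ) ∈ intrinsicInterior ℝ (W : Set (Fin n → ℝ)) := by
  have hle : affineSpan ℝ (W : Set (Fin n → ℝ)) ≤ W.toAffineSubspace := by
    rw [affineSpan_le]; exact fun x hx => hx
  have huniv : ((↑) : affineSpan ℝ (W : Set (Fin n → ℝ)) → Fin n → ℝ) ⁻¹' W = univ :=
    eq_univ_of_forall fun x => hle x.2
  refine mem_intrinsicInterior.mpr ⟨⟨0, subset_affineSpan ℝ _ W.zero_mem⟩, ?_, rfl⟩
  rw [huniv, interior_univ]
  trivial

namespace WeightedComplex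

/-- Two dense open sets meet, so the chosen value is the only one. The relative interior must be
non-empty, as otherwise every `c` qualifies. -/
theorem stableInter_mult_eq {X Y : WeightedComplex n} {γ : Set (Fin n → ℝ)} {c : ℝ}
    (hγ : (intrinsicInterior ℝ γ).Nonempty) (h : X.IsStableMult Y γ c) :
    (X.stableInter Y).mult γ = c := by
  have hex : ∃ c, X.IsStableMult Y γ c := ⟨c, h⟩
  classical
  change (if h : ∃ c, X.IsStableMult Y γ c then h.choose else 0) = c
  rw [dif_pos hex]
  obtain ⟨ω, hω⟩ := hγ
  obtain ⟨U, hUo, hUd, hU⟩ := h ω hω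
  obtain ⟨U', hUo', hUd', hU'⟩ := hex.choose_spec ω hω
  obtain ⟨v, hv, hv'⟩ := (hUd.inter_of_isOpen_left hUd' hUo).nonempty
  exact (hU' v hv').symm.trans (hU v hv)

end WeightedComplex

open WeightedComplex

/-- `Y` is supported on the normal cones of the faces of `P` of dimension at least `r`, weighted
by the normalized volumes of the `r`-dimensional faces. -/
structure IsVolumeFan (P : Set (Fin n → ℝ)) (r : ℕ) (Y : WeightedComplex n) : Prop where
  codim_eq : Y.codim = r
  exists_eq : ∀ C ∈ Y.cells, ∃ F, IsFace P F ∧ C = normalCone P F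
  mem_cells : ∀ F, IsFace P F → dim F = r → normalCone P F ∈ Y.cells
  mult_eq : ∀ F, IsFace P F → dim F = r → Y.mult (normalCone P F) = normalizedVolume F

section

variable {P : Set (Fin n → ℝ)} (hP : IsRationalPolytope P) (hne : P.Nonempty)

include hP hne

theorem IsVolumeFan.facets_eq {r : ℕ} {Y : WeightedComplex n} (h : IsVolumeFan P r Y) :
    Y.facets = normalCone P '' {F | IsFace P F ∧ dim F = r} := by
  ext C
  constructor
  · rintro ⟨hC, hd⟩
    obtain ⟨F, hF, rfl⟩ := h.exists_eq C hC
    have := dim_normalCone_add hP hne hF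
    rw [h.codim_eq] at hd
    exact ⟨F, ⟨hF, by omega⟩, rfl⟩
  · rintro ⟨F, ⟨hF, hd⟩, rfl⟩
    refine ⟨h.mem_cells F hF hd, ?_⟩
    rw [h.codim_eq, ← hd]
    exact dim_normalCone_add hP hne hF

theorem isVolumeFan_tropicalHypersurface : IsVolumeFan P 1 (tropicalHypersurface P) where
  codim_eq := rfl
  exists_eq := by
    rintro C ⟨⟨ω, rfl⟩, -⟩
    exact ⟨_, isFace_face P ω, rfl⟩
  mem_cells := by
    intro F hF hd
    have := dim_normalCone_add hP hne hF
    obtain ⟨ω, rfl⟩ := hF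
    exact ⟨⟨ω, rfl⟩, by omega⟩
  mult_eq := by
    intro F hF hd
    change latticeLength (dualFace P (normalCone P F)) = _
    rw [dualFace_normalCone hF]
    obtain ⟨a, p, q, l, -, -, -, -, h1, h2⟩ :=
      exists_edge (hP.of_isFace hF) (hP.nonempty_of_isFace hne hF) hd
    rw [h1, h2]

theorem IsVolumeFan.mem_linkSupport {r : ℕ} {Y : WeightedComplex n} (h : IsVolumeFan P r Y)
    {ω x : Fin n → ℝ} {G : Set (Fin n → ℝ)} (hG : IsFace (face P ω) G) (hd : dim G = r)
    (hx : x ∈ normalCone (face P ω) G) : x ∈ Y.linkSupport ω := by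
  have hGP : IsFace P G := hP.isFace_trans hne (isFace_face P ω) hG
  refine ⟨normalCone P G, ?_, ?_, hG.subset, ?_⟩
  · rw [h.facets_eq hP hne]
    exact ⟨G, ⟨hGP, hd⟩, rfl⟩
  · rw [h.mult_eq G hGP hd]
    exact ((hP.of_isFace hGP).normalizedVolume_pos (hP.nonempty_of_isFace hne hGP)).ne'
  · rwa [link_normalCone hP hne]

/-- A normal cone contains `ω` exactly when its face lies in `face P ω`, so only faces of that
polytope contribute. -/
theorem IsVolumeFan.finsum_facets {r : ℕ} {Y : WeightedComplex n} (h : IsVolumeFan P r Y)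
    {ω : Fin n → ℝ} {𝒜 : Finset (Set (Fin n → ℝ))}
    (h𝒜 : ∀ G, G ∈ 𝒜 ↔ IsFace (face P ω) G ∧ dim G = r) (f : Set (Fin n → ℝ) → ℝ)
    (hf : ∀ σ, ω ∉ σ → f σ = 0) : ∑ᶠ σ ∈ Y.facets, f σ = ∑ G ∈ 𝒜, f (normalCone P G) := by
  have hfin : {F | IsFace P F ∧ dim F = r}.Finite := hP.finite_faces.subset fun F h => h.1
  rw [h.facets_eq hP hne, finsum_mem_image ((injOn_normalCone P).mono fun F h => h.1),
    finsum_mem_eq_finite_toFinset_sum _ hfin]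
  symm
  apply Finset.sum_subset
  · intro G hG
    obtain ⟨h1, h2⟩ := (h𝒜 G).mp hG
    simpa using ⟨hP.isFace_trans hne (isFace_face P ω) h1, h2⟩
  · intro G hG hG'
    have hG : IsFace P G ∧ dim G = r := by simpa using hG
    refine hf _ fun hω => hG' ((h𝒜 G).mpr ⟨?_, hG.2⟩)
    exact hG.1.of_subset (hP.nonempty_of_isFace hne hG.1) (face_subset P ω) hω

/-- The induction starts at one: for `dim P > 0` the single cell `ℝⁿ` of the zeroth power is not a
normal cone of `P`. Intersecting with `ℝⁿ` keeps the cones and weights, since each link of `ℝⁿ` is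
everything and the index is one. -/
theorem isVolumeFan_stableInter_whole :
    IsVolumeFan P 1 ((tropicalHypersurface P).stableInter (whole n)) where
  codim_eq := rfl
  exists_eq := by
    rintro C ⟨-, ⟨σ, hσ, τ, hτ, rfl⟩, -⟩
    obtain rfl : τ = univ := hτ
    rw [inter_univ]
    exact (isVolumeFan_tropicalHypersurface hP hne).exists_eq σ hσ
  mem_cells := by
    intro F hF hd
    refine ⟨⟨0, zero_mem_normalCone hF.subset⟩, ⟨_, (isVolumeFan_tropicalHypersurface hP
      hne).mem_cells F hF hd, univ, rfl, (inter_univ _).symm⟩, fun ω hω v => ⟨0, ?_, -v, ?_, by simp⟩⟩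
    · have hFω : IsFace (face P ω) F :=
        hF.of_subset (hP.nonempty_of_isFace hne hF) (face_subset P ω) hω
      exact (isVolumeFan_tropicalHypersurface hP hne).mem_linkSupport hP hne hFω hd
        (zero_mem_normalCone hω)
    · exact ⟨univ, ⟨rfl, dim_univ⟩, one_ne_zero, trivial, 1, one_pos, fun _ _ _ => trivial⟩
  mult_eq := by
    intro F hF hd
    have hFne := hP.nonempty_of_isFace hne hF
    refine stableInter_mult_eq
      (Set.Nonempty.intrinsicInterior (convex_normalCone P F)
      ⟨0, zero_mem_normalCone hF.subset⟩) ?_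
    intro ω hω
    have hface := face_eq_of_mem_intrinsicInterior hF hFne hω
    refine ⟨univ, isOpen_univ, dense_univ, fun v _ => ?_⟩
    have hX := isVolumeFan_tropicalHypersurface hP hne
    have hfacets : (whole n).facets = {univ} := by
      ext τ
      refine ⟨fun h => h.1, fun h => ?_⟩
      obtain rfl : τ = univ := h
      exact ⟨rfl, dim_univ⟩
    rw [displacedMult, hX.finsum_facets hP hne (ω := ω) (𝒜 := {F})]
    · rw [Finset.sum_singleton, hfacets, finsum_mem_singleton, if_pos, hX.mult_eq F hF hd]
      · have : lattice (univ : Set (Fin n → ℝ)) = ⊤ := by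
          ext z; simp [mem_lattice, vectorSpan_univ]
        simp [latticeIndex, this, whole]
      · refine ⟨hface.ge, trivial, 0, ?_, -v, ⟨1, one_pos, fun _ _ _ => trivial⟩, by simp⟩
        rw [link_normalCone hP hne, hface]
        exact zero_mem_normalCone Subset.rfl
    · intro G
      rw [hface, Finset.mem_singleton]
      refine ⟨?_, fun h => ?_⟩
      · rintro rfl; exact ⟨isFace_self G, hd⟩
      · by_contra hcon
        have := h.1.dim_lt ((hP.of_isFace hF).nonempty_of_isFace hFne h.1) hcon
        omega
    · intro σ hσ
      simp [hσ]

/-- The inductive step for multiplicities, where edge crossing and pyramid decomposition combine. -/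
theorem IsVolumeFan.isStableMult {r : ℕ} {Y : WeightedComplex n} (hY : IsVolumeFan P r Y)
    {F : Set (Fin n → ℝ)} (hFP : IsFace P F) (hd : dim F = r + 1) :
    (tropicalHypersurface P).IsStableMult Y (normalCone P F) (normalizedVolume F) := by
  classical
  intro ω hω
  have hX := isVolumeFan_tropicalHypersurface hP hne
  have hFne := hP.nonempty_of_isFace hne hFP
  have hF := hP.of_isFace hFP
  have hface := face_eq_of_mem_intrinsicInterior hFP hFne hω
  have hfinE : {E | IsFace F E ∧ dim E = 1}.Finite := hF.finite_faces.subset fun E h => h.1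
  have hfinG : {G | IsFace F G ∧ dim G = r}.Finite := hF.finite_faces.subset fun G h => h.1
  set ℰ := hfinE.toFinset
  set 𝒢 := hfinG.toFinset
  have hℰ : ∀ E, E ∈ ℰ ↔ IsFace F E ∧ dim E = 1 := fun E => by simp [ℰ]
  have h𝒢 : ∀ G, G ∈ 𝒢 ↔ IsFace F G ∧ dim G = r := fun G => by simp [𝒢]
  have hexG : ∀ G, ∃ (u c : Fin n → ℤ) (g : Fin n → ℝ), G ∈ 𝒢 → IsFacetNormal F G u c ∧ g ∈ G := by
    intro G
    by_cases hG : G ∈ 𝒢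
    · obtain ⟨h1, h2⟩ := (h𝒢 G).mp hG
      obtain ⟨u, c, huc⟩ := exists_isFacetNormal hF hFne h1 (by omega)
      obtain ⟨g, hg⟩ := hF.nonempty_of_isFace hFne h1
      exact ⟨u, c, g, fun _ => ⟨huc, hg⟩⟩
    · exact ⟨0, 0, 0, fun h => absurd h hG⟩
  choose u c g hG using hexG
  have hexE : ∀ E, ∃ (a : Fin n → ℝ) (p q : Fin n → ℤ) (l : ℝ), E ∈ ℰ → 0 < l ∧
      lattice E = Submodule.span ℤ {p} ∧ q ⬝ᵥ p = 1 ∧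
      E = (fun t : ℝ => a + t • intVec n p) '' Icc 0 l ∧
      latticeLength E = l ∧ normalizedVolume E = l := by
    intro E
    by_cases hE : E ∈ ℰ
    · obtain ⟨h1, h2⟩ := (hℰ E).mp hE
      obtain ⟨a, p, q, l, h⟩ := exists_edge (hF.of_isFace h1) (hF.nonempty_of_isFace hFne h1) h2
      exact ⟨a, p, q, l, fun _ => h⟩
    · exact ⟨0, 0, 0, 0, fun h => absurd h hE⟩
  choose a p q l hE using hexE
  -- Genericity is needed only relative to the finitely many facet normals of `F`.
  obtain ⟨U, hUo, hUd, hU⟩ := exists_generic hF (𝒰 := (fun G => intVec n (u G)) '' 𝒢)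
    (𝒢.finite_toSet.image _)
  refine ⟨U, hUo, hUd, fun v hv => ?_⟩
  obtain ⟨hv0, hgen⟩ := hU v hv
  obtain ⟨w, hw⟩ := hF.face_nonempty hFne v
  have hvw : face F v = {w} := (subsingleton_of_dim_eq_zero hv0).eq_singleton_of_mem hw
  have hcone : ∀ E ∈ ℰ, ∀ G ∈ 𝒢, (∃ x ∈ normalCone F E, ∃ y ∈ normalCone F G, v = x - y) ↔
      ∃ t : ℝ, 0 ≤ t ∧ v + t • intVec n (u G) ∈ normalCone F E := by
    intro E hEm G hGm
    obtain ⟨huc, hgG⟩ := hG G hGm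
    have hGd := ((h𝒢 G).mp hGm).2
    have hGF : G ≠ F := by rintro rfl; omega
    constructor
    · rintro ⟨x, hx, y, hy, rfl⟩
      obtain ⟨t, ht, hty⟩ := (huc.mem_normalCone_iff hF hGF ⟨_, hgG⟩).mp hy
      refine ⟨t, ht, ?_⟩
      have := (add_mem_normalCone_iff ((hℰ E).mp hEm).1.subset (neg_mem hty)).mpr hx
      convert this using 1
      abel
    · rintro ⟨t, ht, hx⟩
      exact ⟨_, hx, _, smul_mem_normalCone ht huc.mem_normalCone, by simp⟩
  have hterm : ∀ E ∈ ℰ, ∀ G ∈ 𝒢,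
      (if ω ∈ normalCone P E ∧ ω ∈ normalCone P G ∧ ∃ x ∈ link ω (normalCone P E),
          ∃ y ∈ link ω (normalCone P G), v = x - y then
        (tropicalHypersurface P).mult (normalCone P E) * Y.mult (normalCone P G) *
          (latticeIndex (normalCone P E) (normalCone P G) : ℝ)
      else 0) = normalizedVolume G *
        if ∃ t : ℝ, 0 ≤ t ∧ v + t • intVec n (u G) ∈ normalCone F E then
          l E * |intVec n (u G) ⬝ᵥ intVec n (p E)| else 0 := by
    intro E hEm G hGm
    obtain ⟨hEF, hEd⟩ := (hℰ E).mp hEm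
    obtain ⟨hGF, hGd⟩ := (h𝒢 G).mp hGm
    have hEP := hP.isFace_trans hne hFP hEF
    have hGP := hP.isFace_trans hne hFP hGF
    have h1 : ω ∈ normalCone P E := by
      rw [mem_normalCone, hface]; exact hEF.subset
    have h2 : ω ∈ normalCone P G := by
      rw [mem_normalCone, hface]; exact hGF.subset
    obtain ⟨-, hlat, hqp, -, -, hvolE⟩ := hE E hEm
    simp only [h1, h2, true_and, link_normalCone hP hne, hface, hcone E hEm G hGm]
    split_ifs
    · rw [hX.mult_eq E hEP hEd, hY.mult_eq G hGP hGd, hvolE,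
        latticeIndex_normalCone hP hne hEP hGP hEF.subset (hG G hGm).1 hlat hqp,
        intVec_dotProduct_intVec, Nat.cast_natAbs, Int.cast_abs]
      ring
    · rw [mul_zero]
  rw [displacedMult, hX.finsum_facets hP hne (ω := ω) (𝒜 := ℰ) (by rw [hface]; exact hℰ)
    _ (fun σ hσ => by simp [hσ])]
  have hinner : ∀ E ∈ ℰ, (∑ᶠ τ ∈ Y.facets,
      if ω ∈ normalCone P E ∧ ω ∈ τ ∧ ∃ x ∈ link ω (normalCone P E), ∃ y ∈ link ω τ, v = x - y then
        (tropicalHypersurface P).mult (normalCone P E) * Y.mult τ *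
          (latticeIndex (normalCone P E) τ : ℝ) else 0) =
      ∑ G ∈ 𝒢, normalizedVolume G *
        if ∃ t : ℝ, 0 ≤ t ∧ v + t • intVec n (u G) ∈ normalCone F E then
          l E * |intVec n (u G) ⬝ᵥ intVec n (p E)| else 0 := by
    intro E hEm
    rw [hY.finsum_facets hP hne (ω := ω) (𝒜 := 𝒢) (by rw [hface]; exact h𝒢) _
      (fun τ hτ => by simp [hτ])]
    exact Finset.sum_congr rfl fun G hGm => hterm E hEm G hGm
  -- With the facet sum outside, the pyramid decomposition with apex `w` applies termwise: the inner
  -- sum over crossed edges has to be the height of `G` above `w`.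
  rw [Finset.sum_congr rfl hinner, Finset.sum_comm,
    normalizedVolume_eq_sum hF hw.1 hd h𝒢 (fun G h => (hG G h).1) (fun G h => (hG G h).2)]
  refine Finset.sum_congr rfl fun G hGm => ?_
  obtain ⟨huc, hgG⟩ := hG G hGm
  rw [← Finset.mul_sum, ← Finset.sum_filter, sum_extent_crossed_edges hF hvw
    (huc.mem_normalCone hgG) (fun t _ => hgen _ ⟨G, hGm, rfl⟩ t)
    (a := a) (p := fun E => intVec n (p E)) (l := l)]
  · intro E
    rw [Finset.mem_filter, hℰ]
  · intro E hEm
    obtain ⟨h1, -, -, h2, -⟩ := hE E (Finset.mem_filter.mp hEm).1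
    exact ⟨h1, h2⟩

theorem IsVolumeFan.stableInter {r : ℕ} {Y : WeightedComplex n} (hY : IsVolumeFan P r Y) :
    IsVolumeFan P (r + 1) ((tropicalHypersurface P).stableInter Y) where
  codim_eq := by
    change 1 + Y.codim = _
    rw [hY.codim_eq, add_comm]
  exists_eq := by
    rintro C ⟨-, ⟨σ, hσ, τ, hτ, rfl⟩, -⟩
    obtain ⟨E, hE, rfl⟩ := (isVolumeFan_tropicalHypersurface hP hne).exists_eq σ hσ
    obtain ⟨G, hG, rfl⟩ := hY.exists_eq τ hτ
    rw [normalCone_inter]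
    exact exists_isFace_normalCone_eq hP (union_subset hE.subset hG.subset)
      ((hP.nonempty_of_isFace hne hE).mono subset_union_left)
  mem_cells := by
    intro F hF hd
    have hFne := hP.nonempty_of_isFace hne hF
    obtain ⟨G, hG, hGd⟩ := exists_isFace_dim_eq r (hP.of_isFace hF) hFne (by omega)
    have hN := dim_normalCone_add hP hne hF
    -- The cone of `F` is itself a lower-dimensional cell of the hypersurface and lies in the cone
    -- of any face of `F`, so intersecting with the latter returns it.
    refine ⟨⟨0, zero_mem_normalCone hF.subset⟩, ⟨normalCone P F, ?_, normalCone P G,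
      hY.mem_cells G (hP.isFace_trans hne hF hG) hGd,
      (inter_eq_left.mpr (normalCone_anti hG.subset)).symm⟩, fun ω hω v => ?_⟩
    · obtain ⟨ω, rfl⟩ := hF
      exact ⟨⟨ω, rfl⟩, by omega⟩
    · have hdim : r + 1 ≤ dim (face P ω) := hd.ge.trans (dim_mono hω)
      obtain ⟨E, G, hE, hEd, hG, hGd, x, hx, y, hy, hv⟩ :=
        exists_sub_mem_normalCone (hP.face ω) (hP.face_nonempty hne ω) hdim v
      exact ⟨x, (isVolumeFan_tropicalHypersurface hP hne).mem_linkSupport hP hne hE hEd hx,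
        y, hY.mem_linkSupport hP hne hG hGd hy, hv⟩
  mult_eq := fun F hF hd => stableInter_mult_eq
    (Set.Nonempty.intrinsicInterior (convex_normalCone P F)
      ⟨0, zero_mem_normalCone hF.subset⟩)
    (hY.isStableMult hP hne hF hd)

theorem isVolumeFan_tropicalPower (r : ℕ) : IsVolumeFan P (r + 1) (tropicalPower P (r + 1)) := by
  induction r with
  | zero => exact isVolumeFan_stableInter_whole hP hne
  | succ r ih => exact ih.stableInter hP hne

theorem normalizedVolume_eq_one_of_dim_eq_zero (hd : dim P = 0) : normalizedVolume P = 1 := by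
  obtain ⟨x, hx⟩ := hne
  obtain ⟨b⟩ := hP.exists_basis hd
  rw [hP.normalizedVolume_eq b hx (p := x) (by simp), coordVolume]
  have : {y : Fin 0 → ℝ | x + latticeMap (fun i => (b i : Fin n → ℤ)) y ∈ P} = univ :=
    eq_univ_of_forall fun y => by simpa [latticeMap_apply] using hx
  rw [this, Measure.volume_pi_eq_dirac 0]
  simp

end

end StableVolume

/-! ### The top stable power -/

theorem mainTheorem7 (n : ℕ) (P : Set (Fin n → ℝ))
    (hP : StableVolume.IsRationalPolytope P) (hne : P.Nonempty) :
    (StableVolume.tropicalPower P (StableVolume.dim P)).HasMultAt 0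
      (StableVolume.normalizedVolume P) := by
  open StableVolume in
  rcases hd : dim P with _ | r
  -- For a point the power is `ℝⁿ` with multiplicity one, and the normalized volume is one.
  · have hdim : dim (Set.univ : Set (Fin n → ℝ)) + 0 = n := dim_univ
    refine ⟨⟨Set.univ, ⟨rfl, hdim⟩, ?_⟩, fun σ _ _ => ?_⟩
    · exact interior_subset_intrinsicInterior (by rw [interior_univ]; trivial)
    · exact (normalizedVolume_eq_one_of_dim_eq_zero hP hne hd).symm
  · have h := isVolumeFan_tropicalPower hP hne r
    refine ⟨⟨normalCone P P, ?_, ?_⟩, fun σ hσ _ => ?_⟩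
    · rw [h.facets_eq hP hne]
      exact ⟨P, ⟨isFace_self P, hd⟩, rfl⟩
    · rw [normalCone_self]
      exact zero_mem_intrinsicInterior_submodule _
    · rw [h.facets_eq hP hne] at hσ
      obtain ⟨F, ⟨hF, hFd⟩, rfl⟩ := hσ
      -- A proper face has smaller dimension, so the cone of `P` is the only facet.
      obtain rfl : F = P := by
        by_contra hcon
        have := hF.dim_lt (hP.nonempty_of_isFace hne hF) hcon
        omega
      exact h.mult_eq F hF hFd
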